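/- There are numbers $\alpha^{(k)}_i$ ($k\in\mathbb N$, $1\le i\le k$), with $0<\alpha^{(k)}_1<\dots<\alpha^{(k)}_k<1$ for every $k$, such that the following holds. Let $k,n\in\mathbb N$, let $\mu\in\mathbb R^n$, let $\Sigma$ be a positive definite $n\times n$ matrix, let $a\in\mathbb R^n\setminus\{0\}$, let $X\sim\mathcal N_n(\mu,\Sigma)$ be a random vector on some probability space, and put $Y=\sum_{i=1}^n a_iX_i$. Let $q(p)=F_Y^{-1}(p)=\inf\{x\in\mathbb R: F_Y(x)\ge p\}$ for $0<p<1$, where $F_Y$ is the distribution function of $Y$. For $0<\beta_1<\dots<\beta_k<1$ consider the $k+1$ slabs $\{Y<q(\beta_1)\}$, $\{q(\beta_1)<Y<q(\beta_2)\}$, …, $\{q(\beta_{k-1})<Y<q(\beta_k)\}$, $\{q(\beta_k)<Y\}$ (for $k=0$, the whole space), and for an event $B$ of positive probability let $\mathrm{Var}_B[X]=\mathbb E[(X-\mathbb E[X|B])(X-\mathbb E[X|B])^T\,|\,B]$. Then the matrices $\mathrm{Var}_B[X]$ are equal to each other for all $k+1$ slabs $B$ when $(\beta_1,\dots,\beta_k)=(\alpha^{(k)}_1,\dots,\alpha^{(k)}_k)$,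 and this is the only sequence $0<\beta_1<\dots<\beta_k<1$ with this property. In particular the sequence depends only on $k$, and not on $n,\mu,\Sigma,a$. For $k=2$ it splits the probability in the ratio $20/60/20$, to the nearest percent: $|\alpha^{(2)}_1-0.20|<0.005$, $|(\alpha^{(2)}_2-\alpha^{(2)}_1)-0.60|<0.005$ and $|(1-\alpha^{(2)}_2)-0.20|<0.005$. -/

import Mathlib

open MeasureTheory ProbabilityTheory

noncomputable section

/-- The benchmark `Y = aX = ∑ i, a i * X i`. -/
def benchmark {Ω : Type*} {n : ℕ} (a : Fin n → ℝ) (X : Ω → EuclideanSpace ℝ (Fin n)) : Ω → ℝ :=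
  fun ω => ∑ i, a i * X ω i

/-- The quantile function `q = F_Y⁻¹` of a real random variable `Y`: `q(p)` is the least `x` with
`p ≤ F_Y(x)`, where `F_Y` is the distribution function of `Y` (for `0 < p < 1`). -/
def quantile {Ω : Type*} [MeasurableSpace Ω] (P : Measure Ω) (Y : Ω → ℝ) (p : ℝ) : ℝ :=
  sInf {x : ℝ | p ≤ cdf (P.map Y) x}

/-- The `j`-th of the `k + 1` open quantile slabs cut out by the levels `α 0, …, α (k - 1)`:
`Y` lies above the quantile of the level just before `j` (no lower bound if `j = 0`) and below the
quantile of the level just after it (no upper bound if `j = k`). -/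
def quantileSlab {Ω : Type*} [MeasurableSpace Ω] (P : Measure Ω) (Y : Ω → ℝ) {k : ℕ}
    (α : Fin k → ℝ) (j : Fin (k + 1)) : Set Ω :=
  {ω | (∀ i : Fin k, i.succ = j → quantile P Y (α i) < Y ω) ∧
       (∀ i : Fin k, i.castSucc = j → Y ω < quantile P Y (α i))}

/-- The conditional covariance matrix `Var[X | B]`: the matrix of covariances of the coordinates
of `X` under the conditional probability `P[· | B]`. -/
def condCovMatrix {Ω : Type*} [MeasurableSpace Ω] {n : ℕ} (P : Measure Ω)
    (X : Ω → EuclideanSpace ℝ (Fin n)) (B : Set Ω) : Matrix (Fin n) (Fin n) ℝ :=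
  Matrix.of fun r s => covariance (fun ω => X ω r) (fun ω => X ω s) (ProbabilityTheory.cond P B)

/-- `0 < α_1 < … < α_k < 1`. -/
def IsLevelSequence {k : ℕ} (α : Fin k → ℝ) : Prop :=
  StrictMono α ∧ ∀ i, 0 < α i ∧ α i < 1

/-- The conditional covariance matrices of `X` on the `k + 1` quantile slabs of `Y` with levels `α`
are all equal. -/
def EqualSlabCov {Ω : Type*} [MeasurableSpace Ω] {n k : ℕ} (P : Measure Ω)
    (X : Ω → EuclideanSpace ℝ (Fin n)) (Y : Ω → ℝ) (α : Fin k → ℝ) : Prop :=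
  ∀ j j' : Fin (k + 1),
    condCovMatrix P X (quantileSlab P Y α j) = condCovMatrix P X (quantileSlab P Y α j')

end

/-! Write `X = cY + Z`, where `c` is the regression vector `Σa / Var Y`. Then `Z` is uncorrelated
with `Y`, hence independent of it by joint Gaussianity. Conditioning on an event of `Y` therefore
changes the covariance matrix of `X` only in the term `c cᵀ Var[Y | B]`. Since `c ≠ 0`, the matrices
agree on all slabs exactly when the numbers `Var[Y | B]` agree (`equalSlabCov_iff`). Standardizing
`Y` turns these into `σ² * slabVar p q`, where `slabVar p q` is the variance of a standard normal
between its quantiles of levels `p < q`. This removes `n`, `μ`, `Σ` and `a`.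

The analytic core is that `slabVar` strictly increases when the interval grows. For a fixed lower
end, let `M`, `F`, `S` be the iterated integrals of the density `φ`, so `M' = φ`, `F' = M`, `S' =
F`. The truncated variance is `(2SM - F²) / M²`, with derivative `2φ(F² - SM) / M³`, and `F² > SM`
follows by differentiating repeatedly until the sign is evident (`second_mul_mass_lt`). Reflection
gives the other end.

The rest of existence and uniqueness uses only monotonicity, continuity, positivity and smallness on
suitable intervals (`IsIntervalGauge`). Existence is by induction on the number of intervals,
placing the last break point by the intermediate value theorem (`exists_next`). Uniqueness compares
two partitions from left to right (`partition_unique`). For `k = 2` uniqueness forces symmetry,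
which leaves one monotone equation whose root is bracketed numerically. -/

section

open Filter Topology Set

/-! ### The standard normal density, distribution function and partial moments -/

/-- The density of the standard normal distribution. -/
noncomputable def stdPdf (x : ℝ) : ℝ := gaussianPDFReal 0 1 x

/-- The distribution function of the standard normal distribution. -/
noncomputable def stdCdf (x : ℝ) : ℝ := cdf (gaussianReal 0 1) x

lemma stdPdf_eq (x : ℝ) : stdPdf x = (√(2 * Real.pi))⁻¹ * Real.exp (-x ^ 2 / 2) := by
  simp [stdPdf, gaussianPDFReal]

lemma stdPdf_pos (x : ℝ) : 0 < stdPdf x := gaussianPDFReal_pos 0 1 x one_ne_zero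

lemma stdPdf_neg (x : ℝ) : stdPdf (-x) = stdPdf x := by simp [stdPdf_eq]

lemma hasDerivAt_stdPdf (x : ℝ) : HasDerivAt stdPdf (-(x * stdPdf x)) x := by
  have h : HasDerivAt (fun x : ℝ => (√(2 * Real.pi))⁻¹ * Real.exp (-x ^ 2 / 2))
      ((√(2 * Real.pi))⁻¹ * (Real.exp (-x ^ 2 / 2) * (-(2 * x) / 2))) x := by
    have := ((hasDerivAt_pow 2 x).neg.div_const 2).exp.const_mul (√(2 * Real.pi))⁻¹
    simpa using this
  have e : stdPdf = fun x : ℝ => (√(2 * Real.pi))⁻¹ * Real.exp (-x ^ 2 / 2) := funext stdPdf_eq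
  rw [e]
  convert h using 1
  ring

lemma continuous_stdPdf : Continuous stdPdf :=
  continuous_iff_continuousAt.2 fun x => (hasDerivAt_stdPdf x).continuousAt

lemma integrable_stdPdf : Integrable stdPdf := integrable_gaussianPDFReal 0 1

lemma stdCdf_eq_integral (x : ℝ) : stdCdf x = ∫ t in Iic x, stdPdf t := by
  rw [stdCdf, cdf_eq_real, measureReal_def, gaussianReal_apply_eq_integral _ one_ne_zero,
    ENNReal.toReal_ofReal]
  · rfl
  · exact setIntegral_nonneg measurableSet_Iic fun x _ => (stdPdf_pos x).le

lemma stdCdf_sub (x y : ℝ) : stdCdf y - stdCdf x = ∫ t in x..y, stdPdf t := by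
  rw [stdCdf_eq_integral, stdCdf_eq_integral]
  exact intervalIntegral.integral_Iic_sub_Iic integrable_stdPdf.integrableOn
    integrable_stdPdf.integrableOn

lemma hasDerivAt_stdCdf (x : ℝ) : HasDerivAt stdCdf (stdPdf x) x := by
  have h : HasDerivAt (fun y => stdCdf 0 + ∫ t in (0 : ℝ)..y, stdPdf t) (stdPdf x) x :=
    (intervalIntegral.integral_hasDerivAt_right (continuous_stdPdf.intervalIntegrable _ _)
      (continuous_stdPdf.stronglyMeasurableAtFilter _ _) continuous_stdPdf.continuousAt).const_add _
  refine h.congr_of_eventuallyEq (Eventually.of_forall fun y => ?_)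
  simp [← stdCdf_sub]

lemma continuous_stdCdf : Continuous stdCdf :=
  continuous_iff_continuousAt.2 fun x => (hasDerivAt_stdCdf x).continuousAt

lemma strictMono_stdCdf : StrictMono stdCdf :=
  strictMono_of_hasDerivAt_pos hasDerivAt_stdCdf stdPdf_pos

lemma tendsto_stdCdf_atBot : Tendsto stdCdf atBot (𝓝 0) := tendsto_cdf_atBot _

lemma tendsto_stdCdf_atTop : Tendsto stdCdf atTop (𝓝 1) := tendsto_cdf_atTop _

lemma stdCdf_pos (x : ℝ) : 0 < stdCdf x :=
  lt_of_le_of_lt (cdf_nonneg _ (x - 1)) (strictMono_stdCdf (by linarith))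

lemma stdCdf_lt_one (x : ℝ) : stdCdf x < 1 :=
  lt_of_lt_of_le (strictMono_stdCdf (by linarith)) (cdf_le_one _ (x + 1))

lemma stdCdf_neg (x : ℝ) : stdCdf (-x) = 1 - stdCdf x := by
  have h : ∀ y, HasDerivAt (fun y => stdCdf y + stdCdf (-y)) 0 y := fun y => by
    have h2 := (hasDerivAt_stdCdf (-y)).scomp y (hasDerivAt_neg y)
    have := (hasDerivAt_stdCdf y).add h2
    exact this.congr_deriv (by simp [stdPdf_neg])
  have hc : ∀ y, stdCdf y + stdCdf (-y) = stdCdf x + stdCdf (-x) := fun y =>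
    is_const_of_deriv_eq_zero (fun z => (h z).differentiableAt) (fun z => (h z).deriv) y x
  have hl : Tendsto (fun y => stdCdf y + stdCdf (-y)) atTop (𝓝 (1 + 0)) :=
    tendsto_stdCdf_atTop.add (tendsto_stdCdf_atBot.comp tendsto_neg_atTop_atBot)
  simp_rw [hc] at hl
  have := tendsto_nhds_unique tendsto_const_nhds hl
  linarith

lemma tendsto_pow_mul_stdPdf_cocompact (k : ℕ) :
    Tendsto (fun x => x ^ k * stdPdf x) (cocompact ℝ) (𝓝 0) := by
  have h := (tendsto_rpow_abs_mul_exp_neg_mul_sq_cocompact (a := 1 / 2) (by norm_num) k).mul_const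
    (√(2 * Real.pi))⁻¹
  rw [zero_mul] at h
  refine squeeze_zero_norm (fun x => le_of_eq ?_) h
  rw [stdPdf_eq, Real.rpow_natCast, norm_mul, norm_pow, Real.norm_eq_abs, norm_mul,
    Real.norm_of_nonneg (Real.exp_pos _).le, Real.norm_of_nonneg (by positivity)]
  rw [show -x ^ 2 / 2 = -(1 / 2) * x ^ 2 by ring]
  ring

lemma tendsto_pow_mul_stdPdf_atBot (k : ℕ) : Tendsto (fun x => x ^ k * stdPdf x) atBot (𝓝 0) :=
  (tendsto_pow_mul_stdPdf_cocompact k).mono_left atBot_le_cocompact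

lemma tendsto_stdPdf_atBot : Tendsto stdPdf atBot (𝓝 0) := by
  simpa using tendsto_pow_mul_stdPdf_atBot 0

lemma tendsto_mul_stdPdf_atBot : Tendsto (fun x => x * stdPdf x) atBot (𝓝 0) := by
  simpa using tendsto_pow_mul_stdPdf_atBot 1

lemma integrable_pow_mul_stdPdf (k : ℕ) : Integrable (fun x => x ^ k * stdPdf x) := by
  have h := (integrable_rpow_mul_exp_neg_mul_sq (b := 1 / 2) (by norm_num) (s := k)
    (by have : (0 : ℝ) ≤ k := k.cast_nonneg
        linarith)).mul_const (√(2 * Real.pi))⁻¹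
  refine h.congr (Eventually.of_forall fun x => ?_)
  simp only [stdPdf_eq, Real.rpow_natCast]
  rw [show -x ^ 2 / 2 = -(1 / 2) * x ^ 2 by ring]
  ring

lemma integral_Iic_mul_stdPdf (y : ℝ) : ∫ x in Iic y, x * stdPdf x = -stdPdf y := by
  have := integral_Iic_of_hasDerivAt_of_tendsto' (f := fun x => -stdPdf x)
    (f' := fun x => x * stdPdf x) (a := y) (m := 0)
    (fun x _ => (hasDerivAt_stdPdf x).neg.congr_deriv (neg_neg _))
    (by simpa using (integrable_pow_mul_stdPdf 1).integrableOn)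
    (by simpa using tendsto_stdPdf_atBot.neg)
  simpa using this

lemma integral_Iic_sq_mul_stdPdf (y : ℝ) :
    ∫ x in Iic y, x ^ 2 * stdPdf x = stdCdf y - y * stdPdf y := by
  have := integral_Iic_of_hasDerivAt_of_tendsto' (f := fun x => stdCdf x - x * stdPdf x)
    (f' := fun x => x ^ 2 * stdPdf x) (a := y) (m := 0)
    (fun x _ => by
      have := (hasDerivAt_stdCdf x).sub ((hasDerivAt_id x).mul (hasDerivAt_stdPdf x))
      refine this.congr_deriv ?_
      simp only [id]
      ring)
    (integrable_pow_mul_stdPdf 2).integrableOn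
    (by simpa using tendsto_stdCdf_atBot.sub tendsto_mul_stdPdf_atBot)
  simpa using this

/-- On `t ≤ -1` the integrand `φ(t)` is at most `-t φ(t)`, whose integral up to `y` is exactly
`φ(y)`. This passes the decay of the density at `-∞` on to the distribution function. -/
lemma stdCdf_le_stdPdf {y : ℝ} (hy : y ≤ -1) : stdCdf y ≤ stdPdf y := by
  have h := integral_Iic_mul_stdPdf y
  rw [stdCdf_eq_integral, ← neg_neg (stdPdf y), ← h, ← integral_neg]
  refine setIntegral_mono_on integrable_stdPdf.integrableOn ?_ measurableSet_Iic fun x hx => ?_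
  · simpa using (integrable_pow_mul_stdPdf 1).integrableOn.neg
  · have := stdPdf_pos x
    have hx' : x ≤ -1 := le_trans hx hy
    nlinarith

lemma tendsto_pow_mul_stdCdf_atBot (k : ℕ) :
    Tendsto (fun x => x ^ k * stdCdf x) atBot (𝓝 0) := by
  have h := (tendsto_pow_mul_stdPdf_atBot k).norm
  rw [norm_zero] at h
  refine squeeze_zero_norm' ?_ h
  filter_upwards [eventually_le_atBot (-1)] with x hx
  rw [norm_mul, norm_mul, Real.norm_of_nonneg (stdCdf_pos x).le,
    Real.norm_of_nonneg (stdPdf_pos x).le]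
  exact mul_le_mul_of_nonneg_left (stdCdf_le_stdPdf hx) (norm_nonneg _)

/-! ### Monotonicity of the truncated normal variance -/

/-- A function with positive derivative on an interval that tends to `0` at the lower end of the
interval is positive. -/
lemma pos_of_hasDerivAt_pos {f f' : ℝ → ℝ} {s : Set ℝ} {l : Filter ℝ} [l.NeBot]
    (hs : Convex ℝ s) (hl : ∀ y ∈ s, ∀ᶠ z in l, z ∈ s ∧ z < y)
    (hf : ∀ y ∈ s, HasDerivAt f (f' y) y) (hf' : ∀ y ∈ s, 0 < f' y)
    (h0 : Tendsto f l (𝓝 0)) {y : ℝ} (hy : y ∈ s) : 0 < f y := by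
  have hm : StrictMonoOn f s := strictMonoOn_of_deriv_pos hs
    (fun z hz => (hf z hz).continuousAt.continuousWithinAt)
    (fun z hz => by
      rw [(hf z (interior_subset hz)).deriv]
      exact hf' z (interior_subset hz))
  obtain ⟨z, hz, hzy⟩ := (hl y hy).exists
  refine lt_of_le_of_lt ?_ (hm hz hy hzy)
  refine le_of_tendsto h0 ?_
  filter_upwards [hl z hz] with w hw
  exact (hm hw.1 hz hw.2).le

/-- The mass of the standard normal distribution between a lower end with `A₀ = Φ` and `y`. -/
noncomputable def truncMass (A₀ y : ℝ) : ℝ := stdCdf y - A₀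

/-- The first moment of `y - t` over the truncated range, where `A₁` is the density at the lower
end. -/
noncomputable def truncFirst (A₀ A₁ y : ℝ) : ℝ := y * truncMass A₀ y + stdPdf y - A₁

/-- Half the second moment of `y - t` over the truncated range, where `A₂ = x φ(x)` at the lower
end `x`. -/
noncomputable def truncSecond (A₀ A₁ A₂ y : ℝ) : ℝ :=
  ((y ^ 2 + 1) * truncMass A₀ y + y * stdPdf y - 2 * y * A₁ + A₂) / 2

section
variable (A₀ A₁ A₂ y : ℝ)

lemma hasDerivAt_truncMass : HasDerivAt (truncMass A₀) (stdPdf y) y :=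
  (hasDerivAt_stdCdf y).sub_const _

lemma hasDerivAt_truncFirst : HasDerivAt (truncFirst A₀ A₁) (truncMass A₀ y) y := by
  have := (((hasDerivAt_id y).mul (hasDerivAt_truncMass A₀ y)).add (hasDerivAt_stdPdf y)).sub_const
    A₁
  refine this.congr_deriv ?_
  simp

lemma hasDerivAt_truncSecond :
    HasDerivAt (truncSecond A₀ A₁ A₂) (truncFirst A₀ A₁ y) y := by
  have := ((((((hasDerivAt_pow 2 y).add_const 1).mul (hasDerivAt_truncMass A₀ y)).add
    ((hasDerivAt_id y).mul (hasDerivAt_stdPdf y))).sub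
    (((hasDerivAt_id y).const_mul 2).mul_const A₁)).add_const A₂).div_const 2
  refine this.congr_deriv ?_
  simp [truncFirst]
  ring

end

/-- The conditions under which `l` is the filter at the lower end of the range `s` of truncation. -/
structure IsTruncation (A₀ A₁ A₂ : ℝ) (s : Set ℝ) (l : Filter ℝ) : Prop where
  convex : Convex ℝ s
  eventually_mem_lt : ∀ y ∈ s, ∀ᶠ z in l, z ∈ s ∧ z < y
  nonneg : 0 ≤ A₁
  mass : Tendsto (truncMass A₀) l (𝓝 0)
  first : Tendsto (truncFirst A₀ A₁) l (𝓝 0)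
  second : Tendsto (truncSecond A₀ A₁ A₂) l (𝓝 0)
  mul_first : Tendsto (fun y => y * truncFirst A₀ A₁ y) l (𝓝 0)
  mul_second : Tendsto (fun y => y * truncSecond A₀ A₁ A₂ y) l (𝓝 0)

lemma isTruncation_nhdsGT (x : ℝ) :
    IsTruncation (stdCdf x) (stdPdf x) (x * stdPdf x) (Ioi x) (𝓝[>] x) := by
  have h0 : Tendsto (truncMass (stdCdf x)) (𝓝[>] x) (𝓝 0) := by
    have h := (hasDerivAt_truncMass (stdCdf x) x).continuousAt.tendsto
    simp only [truncMass, sub_self] at h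
    exact h.mono_left nhdsWithin_le_nhds
  have h1 : Tendsto (truncFirst (stdCdf x) (stdPdf x)) (𝓝[>] x) (𝓝 0) := by
    have h := (hasDerivAt_truncFirst (stdCdf x) (stdPdf x) x).continuousAt.tendsto
    have e : truncFirst (stdCdf x) (stdPdf x) x = 0 := by simp [truncFirst, truncMass]
    rw [e] at h
    exact h.mono_left nhdsWithin_le_nhds
  have h2 : Tendsto (truncSecond (stdCdf x) (stdPdf x) (x * stdPdf x)) (𝓝[>] x) (𝓝 0) := by
    have h := (hasDerivAt_truncSecond (stdCdf x) (stdPdf x) (x * stdPdf x) x).continuousAt.tendsto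
    have e : truncSecond (stdCdf x) (stdPdf x) (x * stdPdf x) x = 0 := by
      simp [truncSecond, truncMass]
      ring
    rw [e] at h
    exact h.mono_left nhdsWithin_le_nhds
  have hid : Tendsto (fun y : ℝ => y) (𝓝[>] x) (𝓝 x) := nhdsWithin_le_nhds
  refine ⟨convex_Ioi x, fun y hy => ?_, (stdPdf_pos x).le, h0, h1, h2, ?_, ?_⟩
  · exact Ioo_mem_nhdsGT hy
  · simpa using hid.mul h1
  · simpa using hid.mul h2

lemma isTruncation_atBot : IsTruncation 0 0 0 univ atBot := by
  have c := tendsto_pow_mul_stdCdf_atBot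
  have p := tendsto_pow_mul_stdPdf_atBot
  refine ⟨convex_univ, fun y _ => ?_, le_rfl, ?_, ?_, ?_, ?_, ?_⟩
  · filter_upwards [eventually_lt_atBot y] with z hz using ⟨mem_univ z, hz⟩
  · have h := c 0
    refine h.congr fun y => ?_
    simp [truncMass]
  · have h := (c 1).add (p 0)
    rw [add_zero] at h
    refine h.congr fun y => ?_
    simp only [truncFirst, truncMass]
    ring
  · have h := (((c 2).add (c 0)).add (p 1)).div_const 2
    simp only [add_zero, zero_div] at h
    refine h.congr fun y => ?_
    simp only [truncSecond, truncMass]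
    ring
  · have h := (c 2).add (p 1)
    rw [add_zero] at h
    refine h.congr fun y => ?_
    simp only [truncFirst, truncMass]
    ring
  · have h := (((c 3).add (c 1)).add (p 2)).div_const 2
    simp only [add_zero, zero_div] at h
    refine h.congr fun y => ?_
    simp only [truncSecond, truncMass]
    ring

lemma Filter.Tendsto.stdPdf_mul {f : ℝ → ℝ} {l : Filter ℝ} (h : Tendsto f l (𝓝 0)) :
    Tendsto (fun y => stdPdf y * f y) l (𝓝 0) := by
  have h' := h.norm.const_mul (√(2 * Real.pi))⁻¹
  rw [norm_zero, mul_zero] at h'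
  refine squeeze_zero_norm (fun y => ?_) h'
  rw [norm_mul, Real.norm_of_nonneg (stdPdf_pos y).le, stdPdf_eq]
  gcongr
  refine mul_le_of_le_one_right (by positivity) (Real.exp_le_one_iff.2 ?_)
  nlinarith [sq_nonneg y]

namespace IsTruncation

variable {A₀ A₁ A₂ : ℝ} {s : Set ℝ} {l : Filter ℝ} [l.NeBot] (h : IsTruncation A₀ A₁ A₂ s l)
  {y : ℝ} (hy : y ∈ s)

include h hy

lemma truncMass_pos : 0 < truncMass A₀ y :=
  pos_of_hasDerivAt_pos h.convex h.eventually_mem_lt (fun y _ => hasDerivAt_truncMass A₀ y)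
    (fun y _ => stdPdf_pos y) h.mass hy

lemma truncFirst_pos : 0 < truncFirst A₀ A₁ y :=
  pos_of_hasDerivAt_pos h.convex h.eventually_mem_lt (fun y _ => hasDerivAt_truncFirst A₀ A₁ y)
    (fun _ hy => h.truncMass_pos hy) h.first hy

lemma truncSecond_pos : 0 < truncSecond A₀ A₁ A₂ y :=
  pos_of_hasDerivAt_pos h.convex h.eventually_mem_lt
    (fun y _ => hasDerivAt_truncSecond A₀ A₁ A₂ y) (fun _ hy => h.truncFirst_pos hy) h.second hy

/-- Needs an argument because `y` may be negative. The derivative is `φ + F + yM`, and `φ + yM = F +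
A₁` by definition of `F`, so it equals `2F + A₁ > 0`. This is the bottom rung of the ladder leading
to `second_mul_mass_lt`. -/
lemma mass_add_mul_first_pos : 0 < truncMass A₀ y + y * truncFirst A₀ A₁ y :=
  pos_of_hasDerivAt_pos (f' := fun y => 2 * truncFirst A₀ A₁ y + A₁)
    h.convex h.eventually_mem_lt
    (fun y _ => ((hasDerivAt_truncMass A₀ y).add
      ((hasDerivAt_id y).mul (hasDerivAt_truncFirst A₀ A₁ y))).congr_deriv (by
        simp [truncFirst]; ring))
    (fun y hy => by have := h.truncFirst_pos hy; have := h.nonneg; positivity)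
    (by
      have := h.mass.add h.mul_first
      simp at this
      exact this) hy

lemma first_add_mul_second_pos : 0 < truncFirst A₀ A₁ y + y * truncSecond A₀ A₁ A₂ y :=
  pos_of_hasDerivAt_pos
    (f' := fun y => (truncMass A₀ y + y * truncFirst A₀ A₁ y) + truncSecond A₀ A₁ A₂ y)
    h.convex h.eventually_mem_lt
    (fun y _ => ((hasDerivAt_truncFirst A₀ A₁ y).add
      ((hasDerivAt_id y).mul (hasDerivAt_truncSecond A₀ A₁ A₂ y))).congr_deriv (by simp; ring))
    (fun _ hy => add_pos (h.mass_add_mul_first_pos hy) (h.truncSecond_pos hy))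
    (by
      have := h.first.add h.mul_second
      simp at this
      exact this) hy

lemma pdf_mul_first_lt : 0 < truncMass A₀ y ^ 2 - stdPdf y * truncFirst A₀ A₁ y :=
  pos_of_hasDerivAt_pos
    (f' := fun y => stdPdf y * (truncMass A₀ y + y * truncFirst A₀ A₁ y))
    h.convex h.eventually_mem_lt
    (fun y _ => (((hasDerivAt_truncMass A₀ y).pow 2).sub
      ((hasDerivAt_stdPdf y).mul (hasDerivAt_truncFirst A₀ A₁ y))).congr_deriv (by simp; ring))
    (fun y hy => mul_pos (stdPdf_pos y) (h.mass_add_mul_first_pos hy))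
    (by
      have := (h.mass.pow 2).sub h.first.stdPdf_mul
      simp at this
      exact this) hy

lemma pdf_mul_second_lt :
    0 < truncFirst A₀ A₁ y * truncMass A₀ y - stdPdf y * truncSecond A₀ A₁ A₂ y :=
  pos_of_hasDerivAt_pos
    (f' := fun y => (truncMass A₀ y ^ 2 - stdPdf y * truncFirst A₀ A₁ y) +
      stdPdf y * (truncFirst A₀ A₁ y + y * truncSecond A₀ A₁ A₂ y))
    h.convex h.eventually_mem_lt
    (fun y _ => (((hasDerivAt_truncFirst A₀ A₁ y).mul (hasDerivAt_truncMass A₀ y)).sub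
      ((hasDerivAt_stdPdf y).mul (hasDerivAt_truncSecond A₀ A₁ A₂ y))).congr_deriv (by
        ring))
    (fun y hy => add_pos (h.pdf_mul_first_lt hy)
      (mul_pos (stdPdf_pos y) (h.first_add_mul_second_pos hy)))
    (by
      have := (h.first.mul h.mass).sub h.second.stdPdf_mul
      simp at this
      exact this) hy

/-- A log-concavity inequality for `S`, inherited from the log-concave density through two
integrations. The derivative of `F² - SM` is `FM - φS`, whose derivative is in turn `(M² - φF) + φ(F
+ yS)`. The preceding lemmas make both terms positive. -/
lemma second_mul_mass_lt : 0 < truncFirst A₀ A₁ y ^ 2 - truncSecond A₀ A₁ A₂ y * truncMass A₀ y :=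
  pos_of_hasDerivAt_pos
    (f' := fun y => truncFirst A₀ A₁ y * truncMass A₀ y - stdPdf y * truncSecond A₀ A₁ A₂ y)
    h.convex h.eventually_mem_lt
    (fun y _ => (((hasDerivAt_truncFirst A₀ A₁ y).pow 2).sub
      ((hasDerivAt_truncSecond A₀ A₁ A₂ y).mul (hasDerivAt_truncMass A₀ y))).congr_deriv (by
        simp; ring))
    (fun _ hy => h.pdf_mul_second_lt hy)
    (by
      have := (h.first.pow 2).sub (h.second.mul h.mass)
      simp at this
      exact this) hy

/-- Strict Cauchy–Schwarz for the moments of `y - t`, here read off from the derivative `2Sφ`. It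
makes the truncated variance positive. -/
lemma first_sq_lt : 0 < 2 * truncSecond A₀ A₁ A₂ y * truncMass A₀ y - truncFirst A₀ A₁ y ^ 2 :=
  pos_of_hasDerivAt_pos
    (f' := fun y => 2 * truncSecond A₀ A₁ A₂ y * stdPdf y)
    h.convex h.eventually_mem_lt
    (fun y _ => ((((hasDerivAt_truncSecond A₀ A₁ A₂ y).const_mul 2).mul
      (hasDerivAt_truncMass A₀ y)).sub
      ((hasDerivAt_truncFirst A₀ A₁ y).pow 2)).congr_deriv (by simp))
    (fun y hy => by have := h.truncSecond_pos hy; have := stdPdf_pos y; positivity)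
    (by
      have := ((h.second.const_mul 2).mul h.mass).sub (h.first.pow 2)
      simp at this
      exact this) hy

end IsTruncation

/-- The variance of the truncated standard normal distribution. -/
noncomputable def truncVar (A₀ A₁ A₂ y : ℝ) : ℝ :=
  (2 * truncSecond A₀ A₁ A₂ y * truncMass A₀ y - truncFirst A₀ A₁ y ^ 2) / truncMass A₀ y ^ 2

lemma truncVar_eq {A₀ y : ℝ} (A₁ A₂ : ℝ) (hy : truncMass A₀ y ≠ 0) :
    truncVar A₀ A₁ A₂ y =
      1 - (y * stdPdf y - A₂) / (stdCdf y - A₀) - ((stdPdf y - A₁) / (stdCdf y - A₀)) ^ 2 := by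
  have hy' : stdCdf y - A₀ ≠ 0 := hy
  simp only [truncVar, truncSecond, truncFirst, truncMass]
  field_simp
  ring

namespace IsTruncation

variable {A₀ A₁ A₂ : ℝ} {s : Set ℝ} {l : Filter ℝ} [l.NeBot] (h : IsTruncation A₀ A₁ A₂ s l)

include h

lemma truncVar_pos {y : ℝ} (hy : y ∈ s) : 0 < truncVar A₀ A₁ A₂ y :=
  div_pos (h.first_sq_lt hy) (pow_pos (h.truncMass_pos hy) 2)

/-- A restatement of `F² > SM`. Since `F / M` is the mean distance to the upper end `y`, this bounds
the variance whenever that distance is small. -/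
lemma truncVar_lt {y : ℝ} (hy : y ∈ s) :
    truncVar A₀ A₁ A₂ y < (truncFirst A₀ A₁ y / truncMass A₀ y) ^ 2 := by
  rw [truncVar, div_pow]
  have := h.second_mul_mass_lt hy
  have := h.truncMass_pos hy
  gcongr
  linarith

lemma hasDerivAt_truncVar {y : ℝ} (hy : y ∈ s) : HasDerivAt (truncVar A₀ A₁ A₂)
    (2 * stdPdf y * (truncFirst A₀ A₁ y ^ 2 - truncSecond A₀ A₁ A₂ y * truncMass A₀ y) /
      truncMass A₀ y ^ 3) y := by
  have h0 := (h.truncMass_pos hy).ne'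
  have := ((((hasDerivAt_truncSecond A₀ A₁ A₂ y).const_mul 2).mul
      (hasDerivAt_truncMass A₀ y)).sub
      ((hasDerivAt_truncFirst A₀ A₁ y).pow 2)).div ((hasDerivAt_truncMass A₀ y).pow 2)
      (pow_ne_zero 2 h0)
  refine this.congr_deriv ?_
  simp
  field_simp
  ring

lemma strictMonoOn_truncVar : StrictMonoOn (truncVar A₀ A₁ A₂) s :=
  strictMonoOn_of_deriv_pos h.convex
    (fun _ hz => (h.hasDerivAt_truncVar hz).continuousAt.continuousWithinAt)
    (fun z hz => by
      have hz := interior_subset hz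
      rw [(h.hasDerivAt_truncVar hz).deriv]
      have := h.truncMass_pos hz
      have := h.second_mul_mass_lt hz
      have := stdPdf_pos z
      positivity)

end IsTruncation

lemma truncVar_le_sq {x y : ℝ} (hxy : x < y) :
    truncVar (stdCdf x) (stdPdf x) (x * stdPdf x) y ≤ (y - x) ^ 2 := by
  have h := isTruncation_nhdsGT x
  have hm := h.truncMass_pos hxy
  refine (h.truncVar_lt hxy).le.trans ?_
  have h1 : 0 < (y - x) * truncMass (stdCdf x) y - truncFirst (stdCdf x) (stdPdf x) y :=
    pos_of_hasDerivAt_pos (f' := fun y => (y - x) * stdPdf y) h.convex h.eventually_mem_lt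
      (fun y _ => ((((hasDerivAt_id y).sub_const x).mul (hasDerivAt_truncMass (stdCdf x) y)).sub
        (hasDerivAt_truncFirst (stdCdf x) (stdPdf x) y)).congr_deriv (by simp))
      (fun y hy => mul_pos (sub_pos.2 hy) (stdPdf_pos y))
      (by
        have hid : Tendsto (fun y : ℝ => y - x) (𝓝[>] x) (𝓝 (x - x)) :=
          (tendsto_id.mono_left nhdsWithin_le_nhds).sub_const x
        have := (hid.mul h.mass).sub h.first
        simp at this
        exact this) hxy
  have h2 := h.truncFirst_pos hxy
  gcongr
  rw [div_le_iff₀ hm]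
  linarith

lemma truncVar_zero_le {y : ℝ} (hy : y < 0) : truncVar 0 0 0 y ≤ 1 / y ^ 2 := by
  have h := isTruncation_atBot
  have hm := h.truncMass_pos (mem_univ y)
  have h1 := h.truncFirst_pos (mem_univ y)
  have hv := h.first_sq_lt (mem_univ y)
  have e2 : 2 * truncSecond 0 0 0 y * truncMass 0 y - truncFirst 0 0 y ^ 2 =
      truncMass 0 y ^ 2 - (truncFirst 0 0 y - y * truncMass 0 y) * truncFirst 0 0 y := by
    simp only [truncSecond, truncFirst]
    ring
  rw [e2] at hv
  -- Positivity of the variance reads `F² - yMF < M²`. Dropping `F²` and dividing by `M` leaves `-yF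
  -- < M`.
  have key : truncFirst 0 0 y / truncMass 0 y ≤ 1 / (-y) := by
    rw [div_le_div_iff₀ hm (by linarith)]
    nlinarith [mul_pos h1 h1]
  refine (h.truncVar_lt (mem_univ y)).le.trans ?_
  calc _ ≤ (1 / (-y)) ^ 2 := by gcongr
    _ = _ := by rw [div_pow]; simp

/-! ### Passing from points to probability levels -/

/-- The quantile function of the standard normal distribution. -/
noncomputable def stdQuantile (p : ℝ) : ℝ := sInf {x : ℝ | p ≤ stdCdf x}

lemma stdQuantile_stdCdf (x : ℝ) : stdQuantile (stdCdf x) = x := by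
  have : {y : ℝ | stdCdf x ≤ stdCdf y} = Ici x := by
    ext y
    simp [strictMono_stdCdf.le_iff_le]
  rw [stdQuantile, this, csInf_Ici]

lemma exists_stdCdf_eq {p : ℝ} (hp : p ∈ Ioo (0 : ℝ) 1) : ∃ x, stdCdf x = p := by
  obtain ⟨a, ha⟩ := (tendsto_stdCdf_atBot.eventually (gt_mem_nhds hp.1)).exists
  obtain ⟨b, hb⟩ := (tendsto_stdCdf_atTop.eventually (lt_mem_nhds hp.2)).exists
  exact mem_range_of_exists_le_of_exists_ge continuous_stdCdf ⟨a, ha.le⟩ ⟨b, hb.le⟩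

lemma stdCdf_stdQuantile {p : ℝ} (hp : p ∈ Ioo (0 : ℝ) 1) : stdCdf (stdQuantile p) = p := by
  obtain ⟨x, rfl⟩ := exists_stdCdf_eq hp
  rw [stdQuantile_stdCdf]

lemma stdCdf_mem_Ioo (x : ℝ) : stdCdf x ∈ Ioo (0 : ℝ) 1 := ⟨stdCdf_pos x, stdCdf_lt_one x⟩

lemma strictMonoOn_stdQuantile : StrictMonoOn stdQuantile (Ioo 0 1) := by
  intro p hp q hq hpq
  rw [← strictMono_stdCdf.lt_iff_lt, stdCdf_stdQuantile hp, stdCdf_stdQuantile hq]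
  exact hpq

lemma stdQuantile_one_sub {p : ℝ} (hp : p ∈ Ioo (0 : ℝ) 1) :
    stdQuantile (1 - p) = -stdQuantile p := by
  obtain ⟨x, rfl⟩ := exists_stdCdf_eq hp
  rw [← stdCdf_neg, stdQuantile_stdCdf, stdQuantile_stdCdf]

lemma continuousAt_stdQuantile {p : ℝ} (hp : p ∈ Ioo (0 : ℝ) 1) : ContinuousAt stdQuantile p := by
  refine strictMonoOn_stdQuantile.continuousAt_of_image_mem_nhds (Ioo_mem_nhds hp.1 hp.2) ?_
  have : stdQuantile '' Ioo 0 1 = univ := eq_univ_of_forall fun x =>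
    ⟨stdCdf x, stdCdf_mem_Ioo x, stdQuantile_stdCdf x⟩
  rw [this]
  exact univ_mem

lemma tendsto_stdQuantile_nhdsGT_zero : Tendsto stdQuantile (𝓝[>] 0) atBot := by
  refine tendsto_atBot.2 fun M => ?_
  filter_upwards [Ioo_mem_nhdsGT (stdCdf_pos M)] with p hp
  have hp' : p ∈ Ioo (0 : ℝ) 1 := ⟨hp.1, hp.2.trans (stdCdf_lt_one M)⟩
  rw [← strictMono_stdCdf.le_iff_le, stdCdf_stdQuantile hp']
  exact hp.2.le

open Classical in
/-- The function `f ∘ stdQuantile` on `(0, 1)`, extended by zero. -/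
noncomputable def quantilePullback (f : ℝ → ℝ) (p : ℝ) : ℝ :=
  if p ∈ Ioo (0 : ℝ) 1 then f (stdQuantile p) else 0

@[simp] lemma quantilePullback_zero (f : ℝ → ℝ) : quantilePullback f 0 = 0 := by
  simp [quantilePullback]

@[simp] lemma quantilePullback_one (f : ℝ → ℝ) : quantilePullback f 1 = 0 := by
  simp [quantilePullback]

@[simp] lemma quantilePullback_stdCdf (f : ℝ → ℝ) (x : ℝ) :
    quantilePullback f (stdCdf x) = f x := by
  simp [quantilePullback, stdCdf_pos, stdCdf_lt_one, stdQuantile_stdCdf]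

lemma quantilePullback_of_mem (f : ℝ → ℝ) {p : ℝ} (hp : p ∈ Ioo (0 : ℝ) 1) :
    quantilePullback f p = f (stdQuantile p) := if_pos hp

lemma quantilePullback_one_sub (f : ℝ → ℝ) (p : ℝ) :
    quantilePullback f (1 - p) = quantilePullback (fun x => f (-x)) p := by
  by_cases hp : p ∈ Ioo (0 : ℝ) 1
  · have hp' : 1 - p ∈ Ioo (0 : ℝ) 1 := ⟨by linarith [hp.2], by linarith [hp.1]⟩
    rw [quantilePullback_of_mem _ hp, quantilePullback_of_mem _ hp', stdQuantile_one_sub hp]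
  · have hp' : 1 - p ∉ Ioo (0 : ℝ) 1 := fun h => hp ⟨by linarith [h.2], by linarith [h.1]⟩
    rw [quantilePullback, quantilePullback, if_neg hp, if_neg hp']

lemma continuousWithinAt_quantilePullback_zero {f : ℝ → ℝ} (h0 : Tendsto f atBot (𝓝 0)) :
    ContinuousWithinAt (quantilePullback f) (Icc 0 1) 0 := by
  have h : ContinuousWithinAt (quantilePullback f) (Ioi 0) 0 := by
    rw [ContinuousWithinAt, quantilePullback_zero]
    refine (h0.comp tendsto_stdQuantile_nhdsGT_zero).congr' ?_
    filter_upwards [Ioo_mem_nhdsGT (zero_lt_one' ℝ)] with p hp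
    rw [quantilePullback_of_mem f hp, Function.comp]
  refine (continuousWithinAt_insert_self.2 h).mono fun p hp => ?_
  rcases hp.1.eq_or_lt with h | h
  · exact Or.inl h.symm
  · exact Or.inr h

/-- The value `0` at the levels `0` and `1` is the limit of `f` at `-∞` and `+∞`. The end `1` is
reduced to the end `0` by reflection. -/
lemma continuousOn_quantilePullback {f : ℝ → ℝ} (hf : Continuous f) (h0 : Tendsto f atBot (𝓝 0))
    (h1 : Tendsto f atTop (𝓝 0)) : ContinuousOn (quantilePullback f) (Icc 0 1) := by
  intro p hp
  rcases hp.1.eq_or_lt with rfl | hp0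
  · exact continuousWithinAt_quantilePullback_zero h0
  rcases hp.2.eq_or_lt with rfl | hp1
  · have h := continuousWithinAt_quantilePullback_zero (f := fun x => f (-x))
      (h1.comp tendsto_neg_atBot_atTop)
    rw [← sub_self (1 : ℝ)] at h
    have h2 := h.comp (f := fun p : ℝ => 1 - p) (s := Icc 0 1)
      (by fun_prop) (fun p hp => ⟨by linarith [hp.2], by linarith [hp.1]⟩)
    have e : ∀ p, quantilePullback f p =
        (quantilePullback (fun x => f (-x)) ∘ fun p : ℝ => 1 - p) p := fun p => by
      simp [quantilePullback_one_sub]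
    exact h2.congr (fun p _ => e p) (e 1)
  · refine ContinuousAt.continuousWithinAt ?_
    refine (hf.continuousAt.comp (continuousAt_stdQuantile ⟨hp0, hp1⟩)).congr ?_
    filter_upwards [Ioo_mem_nhds hp0 hp1] with q hq
    rw [quantilePullback_of_mem f hq, Function.comp]

/-- The density of the standard normal distribution at its quantile of level `p`. -/
noncomputable def densityQuantile : ℝ → ℝ := quantilePullback stdPdf

/-- The function `x φ(x)` at the quantile `x` of level `p`. -/
noncomputable def mulDensityQuantile : ℝ → ℝ := quantilePullback fun x => x * stdPdf x

lemma continuousOn_densityQuantile : ContinuousOn densityQuantile (Icc 0 1) :=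
  continuousOn_quantilePullback continuous_stdPdf
    tendsto_stdPdf_atBot
    (by simpa using (tendsto_pow_mul_stdPdf_cocompact 0).mono_left atTop_le_cocompact)

lemma continuousOn_mulDensityQuantile : ContinuousOn mulDensityQuantile (Icc 0 1) :=
  continuousOn_quantilePullback (continuous_id.mul continuous_stdPdf)
    tendsto_mul_stdPdf_atBot
    (by simpa using (tendsto_pow_mul_stdPdf_cocompact 1).mono_left atTop_le_cocompact)

lemma densityQuantile_one_sub (p : ℝ) : densityQuantile (1 - p) = densityQuantile p := by
  simp [densityQuantile, quantilePullback_one_sub, stdPdf_neg]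

lemma mulDensityQuantile_one_sub (p : ℝ) :
    mulDensityQuantile (1 - p) = -mulDensityQuantile p := by
  simp only [mulDensityQuantile, quantilePullback_one_sub, stdPdf_neg]
  simp only [quantilePullback]
  split_ifs <;> simp

/-! ### The slab variance as a function of two levels -/

/-- The variance of the standard normal distribution conditioned on lying between its quantiles of
levels `p < q`. -/
noncomputable def slabVar (p q : ℝ) : ℝ :=
  1 - (mulDensityQuantile q - mulDensityQuantile p) / (q - p) -
    ((densityQuantile q - densityQuantile p) / (q - p)) ^ 2

/-- The symmetry `x ↦ -x` of the normal law. It transfers facts about the upper end of a slab to the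
lower end. -/
lemma slabVar_one_sub (p q : ℝ) : slabVar (1 - q) (1 - p) = slabVar p q := by
  simp only [slabVar, densityQuantile_one_sub, mulDensityQuantile_one_sub]
  rw [show 1 - p - (1 - q) = q - p by ring]
  rw [← neg_sub (densityQuantile q), neg_div, neg_sq]
  ring

lemma exists_isTruncation {p : ℝ} (hp : p ∈ Ico (0 : ℝ) 1) : ∃ (s : Set ℝ) (l : Filter ℝ),
    l.NeBot ∧ IsTruncation p (densityQuantile p) (mulDensityQuantile p) s l ∧
      ∀ y, p < stdCdf y → y ∈ s := by
  rcases hp.1.eq_or_lt with rfl | h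
  · refine ⟨univ, atBot, inferInstance, ?_, fun y _ => mem_univ y⟩
    simpa [densityQuantile, mulDensityQuantile] using isTruncation_atBot
  · obtain ⟨x, rfl⟩ := exists_stdCdf_eq ⟨h, hp.2⟩
    refine ⟨Ioi x, 𝓝[>] x, inferInstance, ?_, fun y hy => strictMono_stdCdf.lt_iff_lt.1 hy⟩
    simpa [densityQuantile, mulDensityQuantile] using isTruncation_nhdsGT x

lemma slabVar_stdCdf {p y : ℝ} (h : p < stdCdf y) :
    slabVar p (stdCdf y) = truncVar p (densityQuantile p) (mulDensityQuantile p) y := by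
  rw [truncVar_eq _ _ (sub_pos.2 h).ne']
  simp [slabVar, densityQuantile, mulDensityQuantile]

lemma continuousOn_slabVar_right {p : ℝ} (hp : p ∈ Ico (0 : ℝ) 1) :
    ContinuousOn (slabVar p) (Ioc p 1) := by
  have hs : Ioc p 1 ⊆ Icc 0 1 := fun q hq => ⟨hp.1.trans hq.1.le, hq.2⟩
  have hq : ∀ q ∈ Ioc p 1, q - p ≠ 0 := fun q hq => (sub_pos.2 hq.1).ne'
  have hd : ContinuousOn (fun q : ℝ => q - p) (Ioc p 1) := by fun_prop
  exact (continuousOn_const.sub (((continuousOn_mulDensityQuantile.mono hs).sub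
    continuousOn_const).div hd hq)).sub ((((continuousOn_densityQuantile.mono hs).sub
    continuousOn_const).div hd hq).pow 2)

lemma continuousOn_slabVar_left {q : ℝ} (hq : q ∈ Ioc (0 : ℝ) 1) :
    ContinuousOn (fun p => slabVar p q) (Ico 0 q) := by
  have h := (continuousOn_slabVar_right (p := 1 - q) ⟨by linarith [hq.2], by linarith [hq.1]⟩).comp
    (f := fun p : ℝ => 1 - p) (s := Ico 0 q) (by fun_prop)
    (fun p hp => ⟨by linarith [hp.2], by linarith [hp.1]⟩)
  refine h.congr fun p _ => ?_
  rw [Function.comp, slabVar_one_sub]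

lemma strictMonoOn_slabVar_right {p : ℝ} (hp : p ∈ Ico (0 : ℝ) 1) :
    StrictMonoOn (slabVar p) (Ioc p 1) := by
  obtain ⟨s, l, _, ht, hs⟩ := exists_isTruncation hp
  have key : StrictMonoOn (slabVar p) (Ioo p 1) := by
    intro a ha b hb hab
    obtain ⟨x, rfl⟩ := exists_stdCdf_eq ⟨hp.1.trans_lt ha.1, ha.2⟩
    obtain ⟨y, rfl⟩ := exists_stdCdf_eq ⟨hp.1.trans_lt hb.1, hb.2⟩
    rw [slabVar_stdCdf ha.1, slabVar_stdCdf hb.1]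
    exact ht.strictMonoOn_truncVar (hs x ha.1) (hs y hb.1) (strictMono_stdCdf.lt_iff_lt.1 hab)
  intro a ha b hb hab
  rcases hb.2.eq_or_lt with rfl | hb1
  -- At the level `1` the inequality comes from a limit, which loses strictness. The intermediate
  -- level `c` restores it.
  · obtain ⟨c, hac, hc1⟩ := exists_between hab
    have hc : c ∈ Ioo p 1 := ⟨ha.1.trans hac, hc1⟩
    refine (key ⟨ha.1, hab⟩ hc hac).trans_le ?_
    have hcont := (continuousOn_slabVar_right hp 1 hb).mono_left
      (nhdsWithin_mono 1 (Ioo_subset_Ioc_self : Ioo p 1 ⊆ Ioc p 1))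
    have : (𝓝[Ioo p 1] (1 : ℝ)).NeBot := right_nhdsWithin_Ioo_neBot hp.2
    refine ge_of_tendsto hcont ?_
    rw [nhdsWithin_Ioo_eq_nhdsLT hp.2]
    filter_upwards [Ioo_mem_nhdsLT hc1] with d hd
    exact (key hc ⟨hc.1.trans hd.1, hd.2⟩ hd.1).le
  · exact key ⟨ha.1, hab.trans hb1⟩ ⟨hb.1, hb1⟩ hab

lemma strictAntiOn_slabVar_left {q : ℝ} (hq : q ∈ Ioc (0 : ℝ) 1) :
    StrictAntiOn (fun p => slabVar p q) (Ico 0 q) := by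
  intro a ha b hb hab
  have h := strictMonoOn_slabVar_right (p := 1 - q) ⟨by linarith [hq.2], by linarith [hq.1]⟩
    (a := 1 - b) (b := 1 - a) ⟨by linarith [hb.2], by linarith [hb.1]⟩
    ⟨by linarith [ha.2], by linarith [ha.1]⟩ (by linarith)
  simpa only [slabVar_one_sub] using h

lemma slabVar_pos {p q : ℝ} (hp : 0 ≤ p) (hpq : p < q) (hq : q ≤ 1) : 0 < slabVar p q := by
  have hp' : p ∈ Ico (0 : ℝ) 1 := ⟨hp, hpq.trans_le hq⟩
  obtain ⟨s, l, _, ht, hs⟩ := exists_isTruncation hp'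
  obtain ⟨c, hpc, hcq⟩ := exists_between hpq
  refine lt_trans ?_ (strictMonoOn_slabVar_right hp' ⟨hpc, hcq.le.trans hq⟩ ⟨hpq, hq⟩ hcq)
  obtain ⟨x, rfl⟩ := exists_stdCdf_eq ⟨hp.trans_lt hpc, hcq.trans_le hq⟩
  rw [slabVar_stdCdf hpc]
  exact ht.truncVar_pos (hs x hpc)

lemma exists_slabVar_zero_lt {ε : ℝ} (hε : 0 < ε) : ∃ q ∈ Ioo (0 : ℝ) 1, slabVar 0 q < ε := by
  have h : Tendsto (fun y : ℝ => 1 / y ^ 2) atBot (𝓝 0) := by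
    have := (tendsto_inv_atBot_zero (𝕜 := ℝ)).pow 2
    simpa using this
  obtain ⟨y, hy, hy0⟩ :=
    ((h.eventually (gt_mem_nhds hε)).and (eventually_lt_atBot (0 : ℝ))).exists
  refine ⟨stdCdf y, stdCdf_mem_Ioo y, ?_⟩
  rw [slabVar_stdCdf (stdCdf_pos y)]
  refine lt_of_le_of_lt ?_ hy
  simpa [densityQuantile, mulDensityQuantile] using truncVar_zero_le hy0

lemma exists_slabVar_lt {q ε : ℝ} (hq : q ∈ Ioc (0 : ℝ) 1) (hε : 0 < ε) :
    ∃ p ∈ Ioo (0 : ℝ) q, slabVar p q < ε := by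
  rcases hq.2.eq_or_lt with rfl | h1
  · obtain ⟨p, hp, hV⟩ := exists_slabVar_zero_lt hε
    refine ⟨1 - p, ⟨by linarith [hp.2], by linarith [hp.1]⟩, ?_⟩
    rw [← slabVar_one_sub]
    simpa using hV
  · obtain ⟨y, rfl⟩ := exists_stdCdf_eq ⟨hq.1, h1⟩
    -- An interval of length `√ε / 2` has variance at most `ε / 4` by `truncVar_le_sq`.
    have hs : 0 < √ε := Real.sqrt_pos.2 hε
    have hlt : stdCdf (y - √ε / 2) < stdCdf y := strictMono_stdCdf (by linarith)
    refine ⟨stdCdf (y - √ε / 2), ⟨stdCdf_pos _, hlt⟩, ?_⟩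
    rw [slabVar_stdCdf hlt]
    simp only [densityQuantile, mulDensityQuantile, quantilePullback_stdCdf]
    refine (truncVar_le_sq (by linarith)).trans_lt ?_
    have := Real.sq_sqrt hε.le
    nlinarith

/-! ### Partitions of the unit interval with equal gauge -/

/-- A function of intervals in `[0, 1]` that is positive, strictly increasing under inclusion,
continuous in both ends, and small on small intervals. -/
structure IsIntervalGauge (V : ℝ → ℝ → ℝ) : Prop where
  strictMonoOn_right : ∀ p ∈ Ico (0 : ℝ) 1, StrictMonoOn (V p) (Ioc p 1)
  strictAntiOn_left : ∀ q ∈ Ioc (0 : ℝ) 1, StrictAntiOn (fun p => V p q) (Ico 0 q)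
  continuousOn_right : ∀ p ∈ Ico (0 : ℝ) 1, ContinuousOn (V p) (Ioc p 1)
  continuousOn_left : ∀ q ∈ Ioc (0 : ℝ) 1, ContinuousOn (fun p => V p q) (Ico 0 q)
  pos : ∀ p q, 0 ≤ p → p < q → q ≤ 1 → 0 < V p q
  exists_zero_lt : ∀ ε > 0, ∃ q ∈ Ioo (0 : ℝ) 1, V 0 q < ε
  exists_lt : ∀ q ∈ Ioc (0 : ℝ) 1, ∀ ε > 0, ∃ p ∈ Ioo (0 : ℝ) q, V p q < ε

/-- `w` is positive, continuous and strictly increasing on `(0, 1]` and bounded above by `V 0`. -/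
structure IsPartitionValue (V : ℝ → ℝ → ℝ) (w : ℝ → ℝ) : Prop where
  strictMonoOn : StrictMonoOn w (Ioc 0 1)
  continuousOn : ContinuousOn w (Ioc 0 1)
  pos : ∀ q ∈ Ioc (0 : ℝ) 1, 0 < w q
  le : ∀ q ∈ Ioc (0 : ℝ) 1, w q ≤ V 0 q

namespace IsIntervalGauge

variable {V : ℝ → ℝ → ℝ} (hV : IsIntervalGauge V)

include hV

lemma mono {p p' q q' : ℝ} (hp : 0 ≤ p) (hpp : p ≤ p') (hpq : p' < q) (hqq : q ≤ q')
    (hq : q' ≤ 1) : V p' q ≤ V p q' :=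
  ((hV.strictAntiOn_left q ⟨hp.trans_lt (hpp.trans_lt hpq), hqq.trans hq⟩).antitoneOn
    ⟨hp, hpp.trans_lt hpq⟩ ⟨hp.trans hpp, hpq⟩ hpp).trans
  ((hV.strictMonoOn_right p ⟨hp, hpp.trans_lt (hpq.trans_le (hqq.trans hq))⟩).monotoneOn
    ⟨hpp.trans_lt hpq, hqq.trans hq⟩ ⟨hpp.trans_lt (hpq.trans_le hqq), hq⟩ hqq)

lemma exists_eq {w : ℝ → ℝ} (hw : IsPartitionValue V w) {q : ℝ} (hq : q ∈ Ioc (0 : ℝ) 1) :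
    ∃ x ∈ Ioo 0 q, w x = V x q := by
  have hq0 := hq.1
  have hmid : q / 2 < q := by linarith
  -- The intermediate value theorem is applied to `x ↦ w x - V x q`. Near `0`, `w x ≤ V 0 x` is
  -- below `V (q / 2) q ≤ V x q`. Near `q`, `V x q` is below `w (q / 2) ≤ w x`.
  obtain ⟨r, hr, hVr⟩ := hV.exists_zero_lt (V (q / 2) q)
    (hV.pos _ _ (by linarith) hmid hq.2)
  obtain ⟨b', hb', hVb⟩ := hV.exists_lt q hq (w (q / 2)) (hw.pos _ ⟨by linarith, by linarith [hq.2]⟩)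
  set a := min r (q / 2)
  set b := max b' (q / 2)
  have ha0 : 0 < a := lt_min hr.1 (by linarith)
  have haq : a ≤ q / 2 := min_le_right _ _
  have hbq : b < q := max_lt hb'.2 hmid
  have hqb : q / 2 ≤ b := le_max_right _ _
  have hsub : Icc a b ⊆ Ioc 0 1 := fun x hx =>
    ⟨ha0.trans_le hx.1, hx.2.trans (hbq.le.trans hq.2)⟩
  have hcont : ContinuousOn (fun x => w x - V x q) (Icc a b) :=
    (hw.continuousOn.mono hsub).sub ((hV.continuousOn_left q hq).mono
      fun x hx => ⟨ha0.le.trans hx.1, hx.2.trans_lt hbq⟩)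
  have h1 : w a - V a q ≤ 0 := by
    have e1 := hw.le a ⟨ha0, by linarith [hq.2]⟩
    have e2 : V 0 a ≤ V 0 r := hV.mono le_rfl le_rfl ha0 (min_le_left _ _) hr.2.le
    have e3 : V (q / 2) q ≤ V a q := hV.mono ha0.le haq hmid le_rfl hq.2
    linarith
  have h2 : 0 ≤ w b - V b q := by
    have e1 : V b q ≤ V b' q := hV.mono hb'.1.le (le_max_left _ _) hbq le_rfl hq.2
    have e2 : w (q / 2) ≤ w b := hw.strictMonoOn.monotoneOn ⟨by linarith, by linarith [hq.2]⟩
      (hsub ⟨haq.trans hqb, le_rfl⟩) hqb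
    linarith
  obtain ⟨x, hx, hx0⟩ := intermediate_value_Icc (haq.trans hqb) hcont ⟨h1, h2⟩
  exact ⟨x, ⟨ha0.trans_le hx.1, hx.2.trans_lt hbq⟩, sub_eq_zero.1 hx0⟩

/-- The induction step: if `w x` is the common value of a partition of `[0, x]`, then `ξ q` is the
break point at which a further interval `[ξ q, q]` has that value too. The crossing of the
increasing `w` with the decreasing `V · q` moves right, continuously, as `q` grows, so `w ∘ ξ` can
be used for the next step. -/
lemma exists_next {w : ℝ → ℝ} (hw : IsPartitionValue V w) :
    ∃ ξ : ℝ → ℝ, (∀ q ∈ Ioc (0 : ℝ) 1, ξ q ∈ Ioo 0 q ∧ w (ξ q) = V (ξ q) q) ∧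
      IsPartitionValue V (w ∘ ξ) := by
  choose! ξ hξ hξe using fun q => hV.exists_eq hw (q := q)
  have hmem : ∀ q ∈ Ioc (0 : ℝ) 1, ξ q ∈ Ioc (0 : ℝ) 1 := fun q hq =>
    ⟨(hξ q hq).1, (hξ q hq).2.le.trans hq.2⟩
  have hmono : StrictMonoOn ξ (Ioc 0 1) := by
    intro q hq q' hq' hqq
    by_contra! hle
    have h1 : w (ξ q') ≤ w (ξ q) := hw.strictMonoOn.monotoneOn (hmem q' hq') (hmem q hq) hle
    have h2 : V (ξ q) q < V (ξ q) q' := hV.strictMonoOn_right (ξ q)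
      ⟨(hξ q hq).1.le, (hξ q hq).2.trans_le hq.2⟩ ⟨(hξ q hq).2, hq.2⟩
      ⟨(hξ q hq).2.trans hqq, hq'.2⟩ hqq
    have h3 : V (ξ q) q' ≤ V (ξ q') q' :=
      hV.mono (hξ q' hq').1.le hle ((hξ q hq).2.trans hqq) le_rfl hq'.2
    rw [hξe q hq, hξe q' hq'] at h1
    linarith
  have hcont : ContinuousOn ξ (Ioc 0 1) := by
    intro q hq
    have hx := hξ q hq
    refine tendsto_order.2 ⟨fun a ha => ?_, fun b hb => ?_⟩
    · rcases le_or_gt a 0 with h0 | h0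
      · filter_upwards [self_mem_nhdsWithin] with r hr using h0.trans_lt (hξ r hr).1
      have ha' : a ∈ Ioc (0 : ℝ) 1 := ⟨h0, ha.le.trans (hmem q hq).2⟩
      have haq : a < q := ha.trans hx.2
      -- A strict inequality at `a` persists for `r` near `q`, and for such `r` the crossing point
      -- `ξ r` must lie above `a`. The upper bound is symmetric.
      have h1 : w a < V a q := by
        have e1 := hw.strictMonoOn ha' (hmem q hq) ha
        have e2 := hV.mono h0.le ha.le hx.2 le_rfl hq.2
        rw [hξe q hq] at e1
        linarith
      have hev : ∀ᶠ r in 𝓝[Ioc 0 1] q, r ∈ Ioc a 1 ∧ w a < V a r := by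
        -- Continuity of `V a` is available only on `(a, 1]`, so the neighbourhood is shrunk to it.
        have hsub : 𝓝[Ioc 0 1] q = 𝓝[Ioc a 1] q := by
          refine nhdsWithin_eq_nhdsWithin' (Ioi_mem_nhds haq) ?_
          ext r
          simp only [mem_inter_iff, mem_Ioc, mem_Ioi]
          constructor
          · rintro ⟨⟨_, h⟩, h'⟩
            exact ⟨⟨h', h⟩, h'⟩
          · rintro ⟨⟨_, h⟩, h'⟩
            exact ⟨⟨h0.trans h', h⟩, h'⟩
        rw [hsub]
        filter_upwards [self_mem_nhdsWithin, (hV.continuousOn_right a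
          ⟨h0.le, haq.trans_le hq.2⟩ q ⟨haq, hq.2⟩).eventually (lt_mem_nhds h1)] with r hr hr'
        exact ⟨hr, hr'⟩
      filter_upwards [self_mem_nhdsWithin, hev] with r hr hr'
      by_contra! hle
      have e1 : w (ξ r) ≤ w a := hw.strictMonoOn.monotoneOn (hmem r hr) ha' hle
      have e2 : V a r ≤ V (ξ r) r := hV.mono (hξ r hr).1.le hle hr'.1.1 le_rfl hr.2
      rw [hξe r hr] at e1
      linarith [hr'.2]
    · obtain ⟨c, hxc, hc⟩ := exists_between (lt_min hb hx.2)
      have hcb := hc.trans_le (min_le_left _ _)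
      have hcq := hc.trans_le (min_le_right _ _)
      have hc0 := hx.1.trans hxc
      have hc' : c ∈ Ioc (0 : ℝ) 1 := ⟨hc0, hcq.le.trans hq.2⟩
      have h1 : V c q < w c := by
        have e1 := hw.strictMonoOn (hmem q hq) hc' hxc
        have e2 := hV.mono hx.1.le hxc.le hcq le_rfl hq.2
        rw [hξe q hq] at e1
        linarith
      have hev : ∀ᶠ r in 𝓝[Ioc 0 1] q, r ∈ Ioc c 1 ∧ V c r < w c := by
        have hsub : 𝓝[Ioc 0 1] q = 𝓝[Ioc c 1] q := by
          refine nhdsWithin_eq_nhdsWithin' (Ioi_mem_nhds hcq) ?_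
          ext r
          simp only [mem_inter_iff, mem_Ioc, mem_Ioi]
          constructor
          · rintro ⟨⟨_, h⟩, h'⟩
            exact ⟨⟨h', h⟩, h'⟩
          · rintro ⟨⟨_, h⟩, h'⟩
            exact ⟨⟨hc0.trans h', h⟩, h'⟩
        rw [hsub]
        filter_upwards [self_mem_nhdsWithin, (hV.continuousOn_right c
          ⟨hc0.le, hcq.trans_le hq.2⟩ q ⟨hcq, hq.2⟩).eventually (gt_mem_nhds h1)] with r hr hr'
        exact ⟨hr, hr'⟩
      filter_upwards [self_mem_nhdsWithin, hev] with r hr hr'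
      refine lt_of_lt_of_le ?_ hcb.le
      by_contra! hle
      have e1 : w c ≤ w (ξ r) := hw.strictMonoOn.monotoneOn hc' (hmem r hr) hle
      have e2 : V (ξ r) r ≤ V c r := hV.mono hc0.le hle (hξ r hr).2 le_rfl hr.2
      rw [hξe r hr] at e1
      linarith [hr'.2]
  refine ⟨ξ, fun q hq => ⟨hξ q hq, hξe q hq⟩, ?_, ?_, ?_, ?_⟩
  · exact hw.strictMonoOn.comp hmono hmem
  · exact hw.continuousOn.comp hcont hmem
  · exact fun q hq => hw.pos _ (hmem q hq)
  · intro q hq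
    rw [Function.comp, hξe q hq]
    exact hV.mono le_rfl (hξ q hq).1.le (hξ q hq).2 le_rfl hq.2

lemma exists_partition (k : ℕ) : ∃ w : ℝ → ℝ, IsPartitionValue V w ∧
    ∀ q ∈ Ioc (0 : ℝ) 1, ∃ α : ℕ → ℝ, α 0 = 0 ∧ α (k + 1) = q ∧
      ∀ i ≤ k, α i < α (i + 1) ∧ V (α i) (α (i + 1)) = w q := by
  induction k with
  | zero =>
    refine ⟨V 0, ⟨hV.strictMonoOn_right 0 (by simp), hV.continuousOn_right 0 (by simp),
      fun q hq => hV.pos 0 q le_rfl hq.1 hq.2, fun _ _ => le_rfl⟩, fun q hq => ?_⟩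
    refine ⟨fun i => if i = 0 then 0 else q, by simp, by simp, fun i hi => ?_⟩
    obtain rfl : i = 0 := by omega
    simpa using hq.1
  | succ k ih =>
    obtain ⟨w, hw, hα⟩ := ih
    obtain ⟨ξ, hξ, hw'⟩ := hV.exists_next hw
    refine ⟨w ∘ ξ, hw', fun q hq => ?_⟩
    obtain ⟨hx, he⟩ := hξ q hq
    obtain ⟨α, h0, h1, h2⟩ := hα (ξ q) ⟨hx.1, hx.2.le.trans hq.2⟩
    -- The old partition ends with `ξ q` at index `k + 1`, so the new end point `q` gets index `k +
    -- 2`.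
    refine ⟨Function.update α (k + 2) q, ?_, ?_, fun i hi => ?_⟩
    · rw [Function.update_of_ne (by omega), h0]
    · rw [Function.update_self]
    · rcases hi.eq_or_lt with rfl | hlt
      · rw [Function.update_self, Function.update_of_ne (by omega), h1]
        exact ⟨hx.2, he.symm⟩
      · rw [Function.update_of_ne (by omega), Function.update_of_ne (by omega)]
        exact h2 i (by omega)

/-- If `v < v'`, no interval of `α` can contain the corresponding interval of `β`. Hence `α` stays
behind `β` at every break point and ends strictly before it, although both end at `1`. -/
lemma partition_value_le {k : ℕ} {α β : ℕ → ℝ} {v v' : ℝ} (hα0 : α 0 = 0) (hβ0 : β 0 = 0)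
    (hα1 : α (k + 1) = 1) (hβ1 : β (k + 1) = 1)
    (hα : ∀ i ≤ k, α i < α (i + 1) ∧ V (α i) (α (i + 1)) = v)
    (hβ : ∀ i ≤ k, β i < β (i + 1) ∧ V (β i) (β (i + 1)) = v')
    (hα' : ∀ i ≤ k + 1, 0 ≤ α i ∧ α i ≤ 1) : v' ≤ v := by
  by_contra! hv
  have key : ∀ i ≤ k, α i ≤ β i → α (i + 1) < β (i + 1) := by
    intro i hi hle
    by_contra! h
    have := hV.mono (hα' i (by omega)).1 hle (hβ i hi).1 h (hα' (i + 1) (by omega)).2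
    rw [(hα i hi).2, (hβ i hi).2] at this
    linarith
  have hall : ∀ i ≤ k + 1, α i ≤ β i := by
    intro i
    induction i with
    | zero => intro _; rw [hα0, hβ0]
    | succ i ih => intro hi; exact (key i (by omega) (ih (by omega))).le
  have := key k le_rfl (hall k (by omega))
  rw [hα1, hβ1] at this
  exact lt_irrefl _ this

/-- Once the common values agree, each break point determines the next by strict monotonicity of `V
(α i)`. -/
lemma partition_unique {k : ℕ} {α β : ℕ → ℝ} {v v' : ℝ} (hα0 : α 0 = 0) (hβ0 : β 0 = 0)
    (hα1 : α (k + 1) = 1) (hβ1 : β (k + 1) = 1)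
    (hα : ∀ i ≤ k, α i < α (i + 1) ∧ V (α i) (α (i + 1)) = v)
    (hβ : ∀ i ≤ k, β i < β (i + 1) ∧ V (β i) (β (i + 1)) = v')
    (hα' : ∀ i ≤ k + 1, 0 ≤ α i ∧ α i ≤ 1) (hβ' : ∀ i ≤ k + 1, 0 ≤ β i ∧ β i ≤ 1) :
    ∀ i ≤ k + 1, α i = β i := by
  obtain rfl : v = v' := le_antisymm (hV.partition_value_le hβ0 hα0 hβ1 hα1 hβ hα hβ')
    (hV.partition_value_le hα0 hβ0 hα1 hβ1 hα hβ hα')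
  intro i
  induction i with
  | zero => intro _; rw [hα0, hβ0]
  | succ i ih =>
    intro hi
    have e := ih (by omega)
    have a := hα i (by omega)
    have b := hβ i (by omega)
    rw [← e] at b
    have h1 := hα' (i + 1) hi
    have h2 := hβ' (i + 1) hi
    exact (hV.strictMonoOn_right (α i) ⟨(hα' i (by omega)).1, a.1.trans_le h1.2⟩).injOn
      ⟨a.1, h1.2⟩ ⟨b.1, h2.2⟩ (a.2.trans b.2.symm)

end IsIntervalGauge

/-! ### Level sequences with equal slab variances -/

/-- The levels `β` preceded by `0` and followed by `1`. -/
noncomputable def extendLevels {k : ℕ} (β : Fin k → ℝ) (i : ℕ) : ℝ :=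
  if i = 0 then 0 else if h : i - 1 < k then β ⟨i - 1, h⟩ else 1

section
variable {k : ℕ} (β : Fin k → ℝ)

@[simp] lemma extendLevels_zero : extendLevels β 0 = 0 := by simp [extendLevels]

@[simp] lemma extendLevels_last : extendLevels β (k + 1) = 1 := by simp [extendLevels]

@[simp] lemma extendLevels_succ (i : Fin k) : extendLevels β (i + 1) = β i := by
  simp [extendLevels]

variable {β}

lemma IsLevelSequence.extendLevels_lt (h : IsLevelSequence β) {i : ℕ} (hi : i ≤ k) :
    extendLevels β i < extendLevels β (i + 1) := by
  rcases i with _ | i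
  · rcases k with _ | k
    · simp [extendLevels]
    · simpa [extendLevels] using (h.2 0).1
  · rcases hi.eq_or_lt with rfl | hlt
    · simpa [extendLevels] using (h.2 ⟨i, by omega⟩).2
    · have h1 : i < k := by omega
      simpa [extendLevels, h1, hlt] using h.1 (show (⟨i, h1⟩ : Fin k) < ⟨i + 1, hlt⟩ by simp)

lemma IsLevelSequence.extendLevels_mem (h : IsLevelSequence β) (i : ℕ) :
    0 ≤ extendLevels β i ∧ extendLevels β i ≤ 1 := by
  unfold extendLevels
  split_ifs
  · simp
  · exact ⟨(h.2 _).1.le, (h.2 _).2.le⟩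
  · simp

end

lemma IsIntervalGauge.exists_levels {V : ℝ → ℝ → ℝ} (hV : IsIntervalGauge V) (k : ℕ) :
    ∃ α : Fin k → ℝ, IsLevelSequence α ∧
      (∀ i ≤ k, ∀ j ≤ k, V (extendLevels α i) (extendLevels α (i + 1)) =
        V (extendLevels α j) (extendLevels α (j + 1))) ∧
      ∀ β : Fin k → ℝ, IsLevelSequence β →
        (∀ i ≤ k, ∀ j ≤ k, V (extendLevels β i) (extendLevels β (i + 1)) =
          V (extendLevels β j) (extendLevels β (j + 1))) → β = α := by
  obtain ⟨w, -, hw⟩ := hV.exists_partition k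
  obtain ⟨a, h0, h1, ha⟩ := hw 1 (by simp)
  have hlt : ∀ j ≤ k + 1, ∀ i < j, a i < a j := by
    intro j
    induction j with
    | zero => intro _ i hi; omega
    | succ j ih =>
      intro hj i hi
      have hs := (ha j (by omega)).1
      rcases (Nat.lt_succ_iff.1 hi).eq_or_lt with rfl | h
      · exact hs
      · exact (ih (by omega) i h).trans hs
  set α : Fin k → ℝ := fun i => a (i + 1)
  have hα : IsLevelSequence α := by
    refine ⟨fun i j hij => hlt _ (by omega) _ (by simpa using hij), fun i => ⟨?_, ?_⟩⟩
    · rw [← h0]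
      exact hlt _ (by omega) _ (by omega)
    · rw [← h1]
      exact hlt _ le_rfl _ (by omega)
  have hext : ∀ i ≤ k + 1, extendLevels α i = a i := by
    intro i hi
    rcases i with _ | i
    · simp [h0]
    · rcases hi.eq_or_lt with h | h
      · obtain rfl : i = k := by omega
        simp [h1]
      · exact extendLevels_succ α ⟨i, by omega⟩
  refine ⟨α, hα, fun i hi j hj => ?_, fun β hβ hVβ => ?_⟩
  · rw [hext i (by omega), hext j (by omega), hext (i + 1) (by omega), hext (j + 1) (by omega),
      (ha i hi).2, (ha j hj).2]
  · have := hV.partition_unique (extendLevels_zero β) h0 (extendLevels_last β) h1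
      (fun i hi => ⟨hβ.extendLevels_lt hi, hVβ i hi 0 (Nat.zero_le k)⟩) ha
      (fun i _ => hβ.extendLevels_mem i)
      (fun i hi => by rw [← hext i hi]; exact hα.extendLevels_mem i)
    funext i
    rw [← extendLevels_succ β i, this _ (by omega)]

lemma isIntervalGauge_slabVar : IsIntervalGauge slabVar where
  strictMonoOn_right _ hp := strictMonoOn_slabVar_right hp
  strictAntiOn_left _ hq := strictAntiOn_slabVar_left hq
  continuousOn_right _ hp := continuousOn_slabVar_right hp
  continuousOn_left _ hq := continuousOn_slabVar_left hq
  pos _ _ hp hpq hq := slabVar_pos hp hpq hq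
  exists_zero_lt _ hε := exists_slabVar_zero_lt hε
  exists_lt _ hq _ hε := exists_slabVar_lt hq hε

/-- The slab variances of the standard normal distribution with levels `β` are all equal. -/
def EqualSlabVar {k : ℕ} (β : Fin k → ℝ) : Prop :=
  ∀ i ≤ k, ∀ j ≤ k, slabVar (extendLevels β i) (extendLevels β (i + 1)) =
    slabVar (extendLevels β j) (extendLevels β (j + 1))

lemma exists_equalSlabVar (k : ℕ) : ∃ α : Fin k → ℝ, IsLevelSequence α ∧ EqualSlabVar α ∧
    ∀ β : Fin k → ℝ, IsLevelSequence β → EqualSlabVar β → β = α :=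
  isIntervalGauge_slabVar.exists_levels k

/-! ### Three slabs: the ratio 20/60/20 -/

/-- For two levels, uniqueness forces the outer slabs to have the same probability. -/
lemma two_levels_symm {α : Fin 2 → ℝ} (hα : IsLevelSequence α) (h : EqualSlabVar α)
    (huniq : ∀ β : Fin 2 → ℝ, IsLevelSequence β → EqualSlabVar β → β = α) :
    α 1 = 1 - α 0 := by
  have h01 : α 0 < α 1 := hα.1 (by decide)
  have e : ∀ β : Fin 2 → ℝ, extendLevels β 1 = β 0 ∧ extendLevels β 2 = β 1 ∧
      extendLevels β 3 = 1 := fun β => by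
    simp [extendLevels]
  have hβ : IsLevelSequence ![1 - α 1, 1 - α 0] := by
    refine ⟨Fin.strictMono_iff_lt_succ.2 fun i => ?_, fun i => ?_⟩
    · fin_cases i
      simpa using h01
    · have := hα.2 0
      have := hα.2 1
      fin_cases i <;> simp <;> constructor <;> linarith
  have a0 := h 0 (by norm_num) 1 (by norm_num)
  have a1 := h 1 (by norm_num) 2 (by norm_num)
  simp only [zero_add, Nat.reduceAdd, extendLevels_zero, e] at a0 a1
  have hV : EqualSlabVar ![1 - α 1, 1 - α 0] := by
    have b0 : slabVar 0 (1 - α 1) = slabVar (α 1) 1 := by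
      rw [← slabVar_one_sub (α 1) 1, sub_self]
    have b1 := slabVar_one_sub (α 0) (α 1)
    have b2 : slabVar (1 - α 0) 1 = slabVar 0 (α 0) := by
      rw [← slabVar_one_sub 0 (α 0), sub_zero]
    intro i hi j hj
    interval_cases i <;> interval_cases j <;> simp [e] <;> linarith
  have := huniq _ hβ hV
  have h1 := congrFun this 1
  simpa using h1.symm

lemma slabVar_zero_stdCdf_neg (c : ℝ) : slabVar 0 (stdCdf (-c)) =
    1 + c * stdPdf c / stdCdf (-c) - (stdPdf c / stdCdf (-c)) ^ 2 := by
  simp only [slabVar, mulDensityQuantile, densityQuantile, quantilePullback_stdCdf,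
    quantilePullback_zero, stdPdf_neg, sub_zero]
  ring

lemma slabVar_stdCdf_neg (c : ℝ) : slabVar (stdCdf (-c)) (1 - stdCdf (-c)) =
    1 - 2 * c * stdPdf c / (1 - 2 * stdCdf (-c)) := by
  have h1 : stdCdf c = 1 - stdCdf (-c) := by rw [stdCdf_neg]; ring
  have h2 : stdCdf c - stdCdf (-c) = 1 - 2 * stdCdf (-c) := by rw [h1]; ring
  rw [← h1, slabVar, h2]
  simp only [mulDensityQuantile, densityQuantile, quantilePullback_stdCdf, stdPdf_neg]
  ring

/-- The first factor on the right is positive, so the sign of the difference is that of an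
expression simple enough to evaluate numerically. -/
lemma slabVar_zero_sub_slabVar (c : ℝ) (hc : 0 < c) :
    slabVar 0 (stdCdf (-c)) - slabVar (stdCdf (-c)) (1 - stdCdf (-c)) =
      stdPdf c / (stdCdf (-c) ^ 2 * (1 - 2 * stdCdf (-c))) *
        (c * stdCdf (-c) - stdPdf c * (1 - 2 * stdCdf (-c))) := by
  have h0 := stdCdf_pos (-c)
  have h1 : stdCdf (-c) < 1 - stdCdf (-c) := by
    have := stdCdf_neg c
    have := strictMono_stdCdf (show -c < c by linarith)
    linarith
  rw [slabVar_zero_stdCdf_neg, slabVar_stdCdf_neg]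
  -- The denominator is kept as an atom while fractions are cleared.
  obtain ⟨D, hD⟩ : ∃ D, D = 1 - 2 * stdCdf (-c) := ⟨_, rfl⟩
  have hD0 : D ≠ 0 := by linarith
  rw [← hD]
  field_simp
  rw [hD]
  ring

/-- As `p` grows, the outer slab grows and the middle one shrinks. A sign at a single level thus
places that level on one side of the root. -/
lemma strictMonoOn_outer_sub_inner :
    StrictMonoOn (fun p => slabVar 0 p - slabVar p (1 - p)) (Ioo 0 (1 / 2)) := by
  intro a ha b hb hab
  have h1 := strictMonoOn_slabVar_right (p := 0) (by simp) ⟨ha.1, by linarith [ha.2]⟩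
    ⟨hb.1, by linarith [hb.2]⟩ hab
  have h2 := isIntervalGauge_slabVar.mono (p := a) (p' := b) (q := 1 - b) (q' := 1 - a) ha.1.le
    hab.le (by linarith [hb.2]) (by linarith) (by linarith [ha.1])
  simp only
  linarith

lemma inv_sqrt_two_pi_bounds :
    0.398942 < (√(2 * Real.pi))⁻¹ ∧ (√(2 * Real.pi))⁻¹ < 0.398943 := by
  have h1 := Real.pi_gt_d6
  have h2 := Real.pi_lt_d6
  have hpos : 0 < 2 * Real.pi := by positivity
  constructor
  · rw [lt_inv_comm₀ (by norm_num) (Real.sqrt_pos.2 hpos), Real.sqrt_lt' (by norm_num)]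
    refine (mul_lt_mul_of_pos_left h2 two_pos).trans ?_
    norm_num
  · rw [inv_lt_comm₀ (Real.sqrt_pos.2 hpos) (by norm_num), Real.lt_sqrt (by norm_num)]
    refine lt_trans ?_ (mul_lt_mul_of_pos_left h1 two_pos)
    norm_num

/-- The constant is the remainder factor `(n + 1) / (n! * n)` of `Real.exp_bound` at `n = 6`. -/
lemma abs_exp_neg_sub_le {u : ℝ} (h0 : 0 ≤ u) (h1 : u ≤ 1) :
    |Real.exp (-u) - (1 - u + u ^ 2 / 2 - u ^ 3 / 6 + u ^ 4 / 24 - u ^ 5 / 120)| ≤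
      7 / 4320 * u ^ 6 := by
  have h := Real.exp_bound (x := -u) (by rwa [abs_neg, abs_of_nonneg h0]) (n := 6) (by norm_num)
  rw [abs_neg, abs_of_nonneg h0] at h
  simp only [Finset.sum_range_succ, Finset.sum_range_zero, Nat.factorial] at h
  norm_num at h
  refine le_of_eq_of_le ?_ (h.trans_eq (by ring))
  congr 1
  ring

/-- The Taylor polynomial of `∫ t in 0..c, exp (-t ^ 2 / 2)`. -/
noncomputable def gaussTaylor (c : ℝ) : ℝ :=
  c - c ^ 3 / 6 + c ^ 5 / 40 - c ^ 7 / 336 + c ^ 9 / 3456 - c ^ 11 / 42240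

lemma abs_integral_exp_sub_le {c : ℝ} (h0 : 0 ≤ c) (h1 : c ≤ 1) :
    |(∫ t in (0 : ℝ)..c, Real.exp (-(t ^ 2 / 2))) - gaussTaylor c| ≤ c ^ 13 / 513000 := by
  have hg : gaussTaylor c = ∫ t in (0 : ℝ)..c, (1 - t ^ 2 / 2 + (t ^ 2 / 2) ^ 2 / 2 -
      (t ^ 2 / 2) ^ 3 / 6 + (t ^ 2 / 2) ^ 4 / 24 - (t ^ 2 / 2) ^ 5 / 120) := by
    rw [intervalIntegral.integral_eq_sub_of_hasDerivAt (f := gaussTaylor)]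
    · simp [gaussTaylor]
    · intro t _
      have := ((((((hasDerivAt_id t).sub ((hasDerivAt_pow 3 t).div_const 6)).add
        ((hasDerivAt_pow 5 t).div_const 40)).sub ((hasDerivAt_pow 7 t).div_const 336)).add
        ((hasDerivAt_pow 9 t).div_const 3456)).sub ((hasDerivAt_pow 11 t).div_const 42240))
      refine this.congr_deriv ?_
      norm_num
      ring
    · exact Continuous.intervalIntegrable (by fun_prop) _ _
  rw [hg, ← intervalIntegral.integral_sub (Continuous.intervalIntegrable (by fun_prop) _ _)
    (Continuous.intervalIntegrable (by fun_prop) _ _)]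
  refine (intervalIntegral.abs_integral_le_integral_abs h0).trans ?_
  -- The exact coefficient is `7 / (276480 * 13)`, slightly below `1 / 513000`.
  have hb : ∫ t in (0 : ℝ)..c, 7 / 4320 * (t ^ 2 / 2) ^ 6 ≤ c ^ 13 / 513000 := by
    have : ∀ t : ℝ, 7 / 4320 * (t ^ 2 / 2) ^ 6 = 7 / 276480 * t ^ 12 := fun t => by ring
    simp_rw [this]
    rw [intervalIntegral.integral_const_mul, integral_pow]
    have := pow_nonneg h0 13
    norm_num
    linarith
  refine le_trans (intervalIntegral.integral_mono_on h0
    (Continuous.intervalIntegrable (by fun_prop) _ _)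
    (Continuous.intervalIntegrable (by fun_prop) _ _) fun t ht => ?_) hb
  exact abs_exp_neg_sub_le (by positivity) (by nlinarith [ht.1, ht.2])

lemma stdCdf_zero : stdCdf 0 = 1 / 2 := by
  have := stdCdf_neg 0
  rw [neg_zero] at this
  linarith

lemma stdCdf_neg_eq (c : ℝ) : stdCdf (-c) =
    1 / 2 - (√(2 * Real.pi))⁻¹ * ∫ t in (0 : ℝ)..c, Real.exp (-(t ^ 2 / 2)) := by
  have h := stdCdf_sub 0 c
  simp_rw [stdPdf_eq, neg_div] at h
  rw [intervalIntegral.integral_const_mul, stdCdf_zero] at h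
  rw [stdCdf_neg]
  linarith

lemma stdPdf_eq' (c : ℝ) : stdPdf c = (√(2 * Real.pi))⁻¹ * Real.exp (-(c ^ 2 / 2)) := by
  rw [stdPdf_eq, neg_div]

lemma one_sub_two_mul_eq (c : ℝ) : 1 - 2 * stdCdf (-c) = 2 * (1 / 2 - stdCdf (-c)) := by ring

/-- The middle slab has mass `1 - 2 α 0`, so its tolerance `0.005` requires `α 0` within `0.0025` of
`0.2`. The point `0.8495` must lie beyond the root in `c` and still have lower tail above `0.1975`.
That window is only about `0.002` wide, hence the six-digit bounds. -/
lemma stdCdf_neg_near_lower : 0.1975 < stdCdf (-0.8495) ∧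
    0.8495 * stdCdf (-0.8495) - stdPdf 0.8495 * (1 - 2 * stdCdf (-0.8495)) < 0 := by
  obtain ⟨r1, r2⟩ := inv_sqrt_two_pi_bounds
  have hJ := abs_integral_exp_sub_le (c := 0.8495) (by norm_num) (by norm_num)
  have hE := abs_exp_neg_sub_le (u := 0.8495 ^ 2 / 2) (by norm_num) (by norm_num)
  rw [one_sub_two_mul_eq, stdCdf_neg_eq, stdPdf_eq']
  generalize (∫ t in (0 : ℝ)..0.8495, Real.exp (-(t ^ 2 / 2))) = J at *
  generalize Real.exp (-(0.8495 ^ 2 / 2)) = E at *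
  generalize (√(2 * Real.pi))⁻¹ = r at *
  rw [abs_le, gaussTaylor] at hJ
  rw [abs_le] at hE
  have hJ1 : 0.757496 < J := by norm_num at hJ ⊢; linarith [hJ.1]
  have hJ2 : J < 0.757501 := by norm_num at hJ ⊢; linarith [hJ.2]
  have hE1 : 0.697078 < E := by norm_num at hE ⊢; linarith [hE.1]
  -- The goals are linear in the products `r * J` and `r * E * (r * J)`, which `linarith` can then
  -- treat as atoms.
  have hrJ1 : 0.398942 * 0.757496 < r * J := by gcongr
  have hrJ2 : r * J < 0.398943 * 0.757501 := by gcongr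
  have hrE1 : 0.398942 * 0.697078 < r * E := by gcongr
  have h : 0.398942 * 0.697078 * (0.398942 * 0.757496) < r * E * (r * J) := by gcongr
  constructor
  · norm_num at hrJ2 ⊢; linarith
  · norm_num at hrJ1 h ⊢; linarith

lemma stdCdf_neg_near_upper : stdCdf (-0.84) < 0.2025 ∧
    0 < 0.84 * stdCdf (-0.84) - stdPdf 0.84 * (1 - 2 * stdCdf (-0.84)) := by
  obtain ⟨r1, r2⟩ := inv_sqrt_two_pi_bounds
  have hJ := abs_integral_exp_sub_le (c := 0.84) (by norm_num) (by norm_num)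
  have hE := abs_exp_neg_sub_le (u := 0.84 ^ 2 / 2) (by norm_num) (by norm_num)
  rw [one_sub_two_mul_eq, stdCdf_neg_eq, stdPdf_eq']
  generalize (∫ t in (0 : ℝ)..0.84, Real.exp (-(t ^ 2 / 2))) = J at *
  generalize Real.exp (-(0.84 ^ 2 / 2)) = E at *
  generalize (√(2 * Real.pi))⁻¹ = r at *
  rw [abs_le, gaussTaylor] at hJ
  rw [abs_le] at hE
  have hJ1 : 0.7508 < J := by norm_num at hJ ⊢; linarith [hJ.1]
  have hJ2 : J < 0.75086 := by norm_num at hJ ⊢; linarith [hJ.2]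
  have hE1 : 0.70 < E := by norm_num at hE ⊢; linarith [hE.1]
  have hE2 : E < 0.70273 := by norm_num at hE ⊢; linarith [hE.2]
  have hrJ1 : 0.398942 * 0.7508 < r * J := by gcongr
  have hrJ2 : r * J < 0.398943 * 0.75086 := by gcongr
  have hrE2 : r * E < 0.398943 * 0.70273 := by gcongr
  have h : r * E * (r * J) < 0.398943 * 0.70273 * (0.398943 * 0.75086) := by
    gcongr
  constructor
  · norm_num at hrJ1 ⊢; linarith
  · norm_num at hrJ2 h ⊢; linarith

/-- The common-variance levels for three slabs are close to the ratio `20/60/20`. -/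
lemma two_levels_near {α : Fin 2 → ℝ} (hα : IsLevelSequence α) (h : EqualSlabVar α)
    (huniq : ∀ β : Fin 2 → ℝ, IsLevelSequence β → EqualSlabVar β → β = α) :
    |α 0 - 0.20| < 0.005 ∧ |(α 1 - α 0) - 0.60| < 0.005 ∧ |(1 - α 1) - 0.20| < 0.005 := by
  have hs := two_levels_symm hα h huniq
  have h01 : α 0 < α 1 := hα.1 (by decide)
  have hmem : α 0 ∈ Ioo (0 : ℝ) (1 / 2) := ⟨(hα.2 0).1, by linarith⟩
  have hroot : slabVar 0 (α 0) - slabVar (α 0) (1 - α 0) = 0 := by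
    have := h 0 (by norm_num) 1 (by norm_num)
    rw [← hs]
    simpa [extendLevels, sub_eq_zero] using this
  have hcdf : ∀ c : ℝ, 0 < c → stdCdf (-c) ∈ Ioo (0 : ℝ) (1 / 2) := fun c hc =>
    ⟨stdCdf_pos _, by rw [← stdCdf_zero]; exact strictMono_stdCdf (by linarith)⟩
  have hfac : ∀ c : ℝ, 0 < c → 0 < stdPdf c / (stdCdf (-c) ^ 2 * (1 - 2 * stdCdf (-c))) :=
    fun c hc => by
      have h1 := (hcdf c hc).2
      have h2 := stdCdf_pos (-c)
      have h3 := stdPdf_pos c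
      have h4 : 0 < 1 - 2 * stdCdf (-c) := by linarith
      positivity
  obtain ⟨a1, a2⟩ := stdCdf_neg_near_lower
  obtain ⟨b1, b2⟩ := stdCdf_neg_near_upper
  have hlow : stdCdf (-0.8495) < α 0 := by
    by_contra! hle
    have hm := strictMonoOn_outer_sub_inner.monotoneOn hmem (hcdf 0.8495 (by norm_num)) hle
    simp only [hroot] at hm
    rw [slabVar_zero_sub_slabVar _ (by norm_num)] at hm
    exact absurd (mul_neg_of_pos_of_neg (hfac 0.8495 (by norm_num)) a2) (not_lt.2 hm)
  have hupp : α 0 < stdCdf (-0.84) := by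
    by_contra! hle
    have hm := strictMonoOn_outer_sub_inner.monotoneOn (hcdf 0.84 (by norm_num)) hmem hle
    simp only [hroot] at hm
    rw [slabVar_zero_sub_slabVar _ (by norm_num)] at hm
    exact absurd (mul_pos (hfac 0.84 (by norm_num)) b2) (not_lt.2 hm)
  have h1 := a1.trans hlow
  have h2 := hupp.trans b1
  rw [hs]
  norm_num at h1 h2
  refine ⟨abs_lt.2 ⟨?_, ?_⟩, abs_lt.2 ⟨?_, ?_⟩, abs_lt.2 ⟨?_, ?_⟩⟩ <;> norm_num <;> linarith

/-! ### Conditional moments of the standard normal on a slab -/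

/-- The points below the standard normal quantile of level `q`. -/
def stdLower (q : ℝ) : Set ℝ := {u | 0 < q ∧ (q < 1 → u < stdQuantile q)}

/-- The points between the standard normal quantiles of levels `p` and `q`. -/
def stdSlab (p q : ℝ) : Set ℝ := {u | (0 < p → stdQuantile p < u) ∧ (q < 1 → u < stdQuantile q)}

lemma stdLower_zero : stdLower 0 = ∅ := by simp [stdLower]

lemma stdLower_one : stdLower 1 = univ := by simp [stdLower]

lemma stdLower_stdCdf (x : ℝ) : stdLower (stdCdf x) = Iio x := by
  ext u
  simp [stdLower, stdCdf_pos, stdCdf_lt_one, stdQuantile_stdCdf]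

lemma stdLower_cases {q : ℝ} (hq : q ∈ Icc (0 : ℝ) 1) : q = 0 ∨ q = 1 ∨ ∃ x, q = stdCdf x := by
  rcases hq.1.eq_or_lt with rfl | h0
  · exact Or.inl rfl
  rcases hq.2.eq_or_lt with rfl | h1
  · exact Or.inr (Or.inl rfl)
  obtain ⟨x, hx⟩ := exists_stdCdf_eq ⟨h0, h1⟩
  exact Or.inr (Or.inr ⟨x, hx.symm⟩)

lemma measurableSet_stdLower {q : ℝ} (hq : q ∈ Icc (0 : ℝ) 1) : MeasurableSet (stdLower q) := by
  rcases stdLower_cases hq with rfl | rfl | ⟨x, rfl⟩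
  · simp [stdLower_zero]
  · simp [stdLower_one]
  · simp [stdLower_stdCdf]

lemma measurableSet_stdSlab (p q : ℝ) : MeasurableSet (stdSlab p q) := by
  have : stdSlab p q = (if 0 < p then Ioi (stdQuantile p) else univ) ∩
      (if q < 1 then Iio (stdQuantile q) else univ) := by
    ext u
    by_cases h1 : 0 < p <;> by_cases h2 : q < 1 <;> simp [stdSlab, h1, h2]
  rw [this]
  split_ifs <;> measurability

lemma integral_one_stdPdf : ∫ x, stdPdf x = 1 := integral_gaussianPDFReal_eq_one 0 one_ne_zero

lemma integral_mul_stdPdf : ∫ x, x * stdPdf x = 0 := by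
  have h : ∫ x, x ∂(gaussianReal 0 1) = 0 := integral_id_gaussianReal
  rw [integral_gaussianReal_eq_integral_smul one_ne_zero] at h
  simpa [stdPdf, mul_comm] using h

lemma integral_sq_mul_stdPdf : ∫ x, x ^ 2 * stdPdf x = 1 := by
  have h := variance_id_gaussianReal (μ := 0) (v := 1)
  rw [variance_eq_sub (memLp_id_gaussianReal 2)] at h
  simp only [id_eq, integral_id_gaussianReal, Pi.pow_apply] at h
  rw [integral_gaussianReal_eq_integral_smul one_ne_zero] at h
  simpa [stdPdf, mul_comm] using h

lemma setIntegral_stdLower_one {q : ℝ} (hq : q ∈ Icc (0 : ℝ) 1) :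
    ∫ x in stdLower q, stdPdf x = q := by
  rcases stdLower_cases hq with rfl | rfl | ⟨x, rfl⟩
  · simp [stdLower_zero]
  · simp [stdLower_one, integral_one_stdPdf]
  · rw [stdLower_stdCdf, ← integral_Iic_eq_integral_Iio, stdCdf_eq_integral]

lemma setIntegral_stdLower_mul {q : ℝ} (hq : q ∈ Icc (0 : ℝ) 1) :
    ∫ x in stdLower q, x * stdPdf x = -densityQuantile q := by
  rcases stdLower_cases hq with rfl | rfl | ⟨x, rfl⟩
  · simp [stdLower_zero, densityQuantile]
  · simp [stdLower_one, integral_mul_stdPdf, densityQuantile]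
  · rw [stdLower_stdCdf, ← integral_Iic_eq_integral_Iio, integral_Iic_mul_stdPdf, densityQuantile,
      quantilePullback_stdCdf]

lemma setIntegral_stdLower_sq {q : ℝ} (hq : q ∈ Icc (0 : ℝ) 1) :
    ∫ x in stdLower q, x ^ 2 * stdPdf x = q - mulDensityQuantile q := by
  rcases stdLower_cases hq with rfl | rfl | ⟨x, rfl⟩
  · simp [stdLower_zero, mulDensityQuantile]
  · simp [stdLower_one, integral_sq_mul_stdPdf, mulDensityQuantile]
  · rw [stdLower_stdCdf, ← integral_Iic_eq_integral_Iio, integral_Iic_sq_mul_stdPdf,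
      mulDensityQuantile, quantilePullback_stdCdf]

lemma stdLower_subset {p q : ℝ} (hp : 0 ≤ p) (hpq : p < q) :
    stdLower p ⊆ stdLower q := by
  intro u hu
  refine ⟨hp.trans_lt hpq, fun h1 => (hu.2 (hpq.trans h1)).trans ?_⟩
  exact strictMonoOn_stdQuantile ⟨hu.1, hpq.trans h1⟩ ⟨hp.trans_lt hpq, h1⟩ hpq

/-- The two sets can differ only at the lower quantile, a null set. Slab integrals thus become
differences of the partial moments over `stdLower`. -/
lemma stdSlab_ae_eq {p q : ℝ} (hp : 0 ≤ p) (hpq : p < q) (hq : q ≤ 1) :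
    (stdSlab p q : Set ℝ) =ᵐ[volume] (stdLower q \ stdLower p : Set ℝ) := by
  have hne : ∀ᵐ u : ℝ, u ≠ stdQuantile p := by
    simp [ae_iff]
  filter_upwards [hne] with u hu
  have hp1 : p < 1 := hpq.trans_le hq
  have hq0 : 0 < q := hp.trans_lt hpq
  apply propext
  change ((0 < p → stdQuantile p < u) ∧ (q < 1 → u < stdQuantile q)) ↔
    ((0 < q ∧ (q < 1 → u < stdQuantile q)) ∧ ¬ (0 < p ∧ (p < 1 → u < stdQuantile p)))
  constructor
  · rintro ⟨h1, h2⟩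
    exact ⟨⟨hq0, h2⟩, fun h => lt_asymm (h1 h.1) (h.2 hp1)⟩
  · rintro ⟨h1, h2⟩
    refine ⟨fun h0 => ?_, h1.2⟩
    by_contra! hle
    exact h2 ⟨h0, fun _ => lt_of_le_of_ne hle hu⟩

lemma setIntegral_stdSlab {f : ℝ → ℝ} (hf : Integrable f) {p q : ℝ} (hp : 0 ≤ p) (hpq : p < q)
    (hq : q ≤ 1) :
    ∫ x in stdSlab p q, f x = (∫ x in stdLower q, f x) - ∫ x in stdLower p, f x := by
  rw [setIntegral_congr_set (stdSlab_ae_eq hp hpq hq)]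
  exact setIntegral_sdiff (measurableSet_stdLower ⟨hp, hpq.le.trans hq⟩) hf.integrableOn
    (stdLower_subset hp hpq)

lemma setIntegral_gaussianReal_std (f : ℝ → ℝ) {s : Set ℝ} (hs : MeasurableSet s) :
    ∫ x in s, f x ∂(gaussianReal 0 1) = ∫ x in s, f x * stdPdf x := by
  rw [← integral_indicator hs, integral_gaussianReal_eq_integral_smul one_ne_zero,
    ← integral_indicator hs]
  congr 1
  ext x
  by_cases hx : x ∈ s <;> simp [hx, stdPdf, mul_comm]

lemma gaussianReal_stdSlab {p q : ℝ} (hp : 0 ≤ p) (hpq : p < q) (hq : q ≤ 1) :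
    (gaussianReal 0 1).real (stdSlab p q) = q - p := by
  have h := setIntegral_gaussianReal_std (fun _ => 1) (measurableSet_stdSlab p q)
  rw [setIntegral_const, smul_eq_mul, mul_one] at h
  rw [h]
  simp_rw [one_mul]
  rw [setIntegral_stdSlab integrable_stdPdf hp hpq hq,
    setIntegral_stdLower_one ⟨hp.trans hpq.le, hq⟩, setIntegral_stdLower_one ⟨hp, hpq.le.trans hq⟩]

lemma integral_cond_eq {α : Type*} [MeasurableSpace α] (μ : Measure α) (s : Set α) (f : α → ℝ) :
    ∫ x, f x ∂(ProbabilityTheory.cond μ s) = (μ.real s)⁻¹ * ∫ x in s, f x ∂μ := by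
  rw [ProbabilityTheory.cond, integral_smul_measure, ENNReal.toReal_inv, smul_eq_mul, measureReal_def]

lemma memLp_cond {α : Type*} [MeasurableSpace α] {μ : Measure α} {s : Set α} (hs : μ s ≠ 0)
    {f : α → ℝ} {r : ENNReal} (hf : MemLp f r μ) : MemLp f r (ProbabilityTheory.cond μ s) :=
  (hf.restrict s).smul_measure (ENNReal.inv_ne_top.2 hs)

/-- The conditional variance of the standard normal distribution on a quantile slab. -/
lemma variance_cond_stdSlab {p q : ℝ} (hp : 0 ≤ p) (hpq : p < q) (hq : q ≤ 1) :
    Var[id; ProbabilityTheory.cond (gaussianReal 0 1) (stdSlab p q)] = slabVar p q := by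
  have hm := gaussianReal_stdSlab hp hpq hq
  have hpos : 0 < q - p := sub_pos.2 hpq
  have h0 : gaussianReal 0 1 (stdSlab p q) ≠ 0 := fun h => by
    rw [measureReal_def, h] at hm
    simp at hm
    linarith
  have hp' : p ∈ Icc (0 : ℝ) 1 := ⟨hp, hpq.le.trans hq⟩
  have hq' : q ∈ Icc (0 : ℝ) 1 := ⟨hp.trans hpq.le, hq⟩
  have := cond_isProbabilityMeasure (μ := gaussianReal 0 1) h0
  rw [variance_eq_sub (memLp_cond h0 (memLp_id_gaussianReal 2)), integral_cond_eq, integral_cond_eq,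
    hm]
  simp only [Pi.pow_apply, id]
  rw [setIntegral_gaussianReal_std _ (measurableSet_stdSlab p q),
    setIntegral_gaussianReal_std _ (measurableSet_stdSlab p q),
    setIntegral_stdSlab (integrable_pow_mul_stdPdf 2) hp hpq hq,
    setIntegral_stdSlab (by simpa using integrable_pow_mul_stdPdf 1) hp hpq hq,
    setIntegral_stdLower_sq hp', setIntegral_stdLower_sq hq', setIntegral_stdLower_mul hp',
    setIntegral_stdLower_mul hq', slabVar]
  field_simp
  ring

/-! ### Conditioning on one of two independent variables -/

section independence

variable {Ω E : Type*} [MeasurableSpace Ω] [MeasurableSpace E] {P : Measure Ω}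
  {Y : Ω → ℝ} {Z : Ω → E} {I : Set ℝ}

lemma ProbabilityTheory.IndepFun.cond_inter_preimage (hYZ : IndepFun Y Z P) (hY : Measurable Y)
    (hI : MeasurableSet I) {A : Set ℝ} {C : Set E} (hA : MeasurableSet A) (hC : MeasurableSet C) :
    ProbabilityTheory.cond P (Y ⁻¹' I) (Y ⁻¹' A ∩ Z ⁻¹' C) =
      ProbabilityTheory.cond P (Y ⁻¹' I) (Y ⁻¹' A) * P (Z ⁻¹' C) := by
  rw [cond_apply (hY hI), cond_apply (hY hI), ← inter_assoc, ← preimage_inter,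
    hYZ.measure_inter_preimage_eq_mul _ _ (hI.inter hA) hC, mul_assoc]

variable [IsProbabilityMeasure P]

lemma ProbabilityTheory.IndepFun.cond_preimage (hYZ : IndepFun Y Z P) (hY : Measurable Y)
    (hI : MeasurableSet I) (hP : P (Y ⁻¹' I) ≠ 0) {C : Set E} (hC : MeasurableSet C) :
    ProbabilityTheory.cond P (Y ⁻¹' I) (Z ⁻¹' C) = P (Z ⁻¹' C) := by
  have := cond_isProbabilityMeasure hP
  have h := hYZ.cond_inter_preimage hY hI MeasurableSet.univ hC
  simpa using h

lemma ProbabilityTheory.IndepFun.indepFun_cond (hYZ : IndepFun Y Z P) (hY : Measurable Y)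
    (hI : MeasurableSet I) (hP : P (Y ⁻¹' I) ≠ 0) :
    IndepFun Y Z (ProbabilityTheory.cond P (Y ⁻¹' I)) := by
  rw [indepFun_iff_measure_inter_preimage_eq_mul]
  intro A C hA hC
  rw [hYZ.cond_inter_preimage hY hI hA hC, hYZ.cond_preimage hY hI hP hC]

lemma ProbabilityTheory.IndepFun.map_cond (hYZ : IndepFun Y Z P) (hY : Measurable Y)
    (hZ : Measurable Z) (hI : MeasurableSet I) (hP : P (Y ⁻¹' I) ≠ 0) :
    (ProbabilityTheory.cond P (Y ⁻¹' I)).map Z = P.map Z := by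
  ext C hC
  rw [Measure.map_apply hZ hC, Measure.map_apply hZ hC, hYZ.cond_preimage hY hI hP hC]

/-- If `Y` is independent of `Z`, conditioning on an event of `Y` changes the covariances of
`c r * Y + Z r` only through the conditional variance of `Y`. -/
lemma covariance_cond_add {ι : Type*} {Z : Ω → ι → ℝ} (hYZ : IndepFun Y Z P)
    (hY : Measurable Y) (hZ : Measurable Z) (hI : MeasurableSet I) (hP : P (Y ⁻¹' I) ≠ 0)
    (hY2 : MemLp Y 2 P) (hZ2 : ∀ r, MemLp (fun ω => Z ω r) 2 P) (c : ι → ℝ) (r s : ι) :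
    cov[fun ω => c r * Y ω + Z ω r, fun ω => c s * Y ω + Z ω s;
        ProbabilityTheory.cond P (Y ⁻¹' I)] =
      c r * c s * Var[Y; ProbabilityTheory.cond P (Y ⁻¹' I)] +
        cov[fun ω => Z ω r, fun ω => Z ω s; P] := by
  have := cond_isProbabilityMeasure hP
  have hind := hYZ.indepFun_cond hY hI hP
  have hmap := hYZ.map_cond hY hZ hI hP
  -- Conditioning on an event of `Y` leaves the law of `Z` unchanged, so its covariances may be
  -- computed under the conditional measure.
  have hzz : cov[fun ω => Z ω r, fun ω => Z ω s; P] =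
      cov[fun ω => Z ω r, fun ω => Z ω s; ProbabilityTheory.cond P (Y ⁻¹' I)] := by
    have h1 := covariance_map_fun (μ := P) (Z := Z) (X := fun z => z r) (Y := fun z => z s)
      (measurable_pi_apply r).aestronglyMeasurable (measurable_pi_apply s).aestronglyMeasurable
      hZ.aemeasurable
    have h2 := covariance_map_fun (μ := ProbabilityTheory.cond P (Y ⁻¹' I)) (Z := Z)
      (X := fun z => z r) (Y := fun z => z s)
      (measurable_pi_apply r).aestronglyMeasurable (measurable_pi_apply s).aestronglyMeasurable
      hZ.aemeasurable
    rw [← h1, ← h2, hmap]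
  rw [hzz]
  have hY2' := memLp_cond hP hY2
  have hZ2' := fun r => memLp_cond hP (hZ2 r)
  generalize ProbabilityTheory.cond P (Y ⁻¹' I) = Q at *
  have hyz : ∀ r, cov[Y, fun ω => Z ω r; Q] = 0 := fun r =>
    (hind.comp measurable_id (measurable_pi_apply r)).covariance_eq_zero hY2' (hZ2' r)
  have hzy : ∀ r, cov[fun ω => Z ω r, Y; Q] = 0 := fun r => by rw [covariance_comm, hyz]
  have e : ∀ r, (fun ω => c r * Y ω + Z ω r) = (fun ω => c r * Y ω) + fun ω => Z ω r :=
    fun r => rfl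
  rw [e, e, covariance_add_left (hY2'.const_mul _) (hZ2' r) ((hY2'.const_mul _).add (hZ2' s)),
    covariance_add_right (hY2'.const_mul _) (hY2'.const_mul _) (hZ2' s),
    covariance_add_right (hZ2' r) (hY2'.const_mul _) (hZ2' s), covariance_const_mul_left,
    covariance_const_mul_right, covariance_const_mul_left, covariance_const_mul_right, hyz, hzy,
    covariance_self hY2'.aemeasurable]
  ring

end independence

/-! ### Reduction to the identity map on the Gaussian space -/

section transfer

lemma map_cond_preimage {Ω E : Type*} [MeasurableSpace Ω] [MeasurableSpace E] {P : Measure Ω}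
    {X : Ω → E} (hX : AEMeasurable X P) {T : Set E} (hT : MeasurableSet T) :
    (ProbabilityTheory.cond P (X ⁻¹' T)).map X = ProbabilityTheory.cond (P.map X) T := by
  rw [ProbabilityTheory.cond, ProbabilityTheory.cond, Measure.map_smul,
    Measure.restrict_map_of_aemeasurable hX hT, Measure.map_apply_of_aemeasurable hX hT]

variable {Ω : Type*} [MeasurableSpace Ω] {n k : ℕ} {P : Measure Ω}
  {N : Measure (EuclideanSpace ℝ (Fin n))} {X : Ω → EuclideanSpace ℝ (Fin n)}

lemma measurable_benchmark (a : Fin n → ℝ) :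
    Measurable (benchmark a (id : EuclideanSpace ℝ (Fin n) → _)) := by
  unfold benchmark
  fun_prop

lemma quantile_benchmark (hX : HasLaw X N P) (a : Fin n → ℝ) :
    quantile P (benchmark a X) = quantile N (benchmark a id) := by
  have : P.map (benchmark a X) = N.map (benchmark a id) := by
    rw [← hX.map_eq, AEMeasurable.map_map_of_aemeasurable
      (measurable_benchmark a).aemeasurable hX.aemeasurable]
    rfl
  funext p
  rw [quantile, quantile, this]

lemma quantileSlab_benchmark (hX : HasLaw X N P) (a : Fin n → ℝ) (β : Fin k → ℝ)
    (j : Fin (k + 1)) : quantileSlab P (benchmark a X) β j =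
      X ⁻¹' quantileSlab N (benchmark a id) β j := by
  rw [quantileSlab, quantileSlab, quantile_benchmark hX]
  rfl

lemma measurableSet_quantileSlab {Y : Ω → ℝ} (hY : Measurable Y) (β : Fin k → ℝ)
    (j : Fin (k + 1)) : MeasurableSet (quantileSlab P Y β j) := by
  refine (MeasurableSet.iInter fun i => ?_).inter (MeasurableSet.iInter fun i => ?_)
    |>.congr (s := (⋂ i : Fin k, {ω | i.succ = j → quantile P Y (β i) < Y ω}) ∩
      ⋂ i : Fin k, {ω | i.castSucc = j → Y ω < quantile P Y (β i)}) ?_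
  · exact MeasurableSet.const _ |>.imp (measurableSet_lt measurable_const hY)
  · exact MeasurableSet.const _ |>.imp (measurableSet_lt hY measurable_const)
  · ext ω
    simp [quantileSlab]

lemma condCovMatrix_preimage (hX : HasLaw X N P) {T : Set (EuclideanSpace ℝ (Fin n))}
    (hT : MeasurableSet T) : condCovMatrix P X (X ⁻¹' T) = condCovMatrix N id T := by
  ext r s
  have hX' : AEMeasurable X (ProbabilityTheory.cond P (X ⁻¹' T)) :=
    hX.aemeasurable.mono_ac cond_absolutelyContinuous
  simp only [condCovMatrix, Matrix.of_apply]
  rw [← hX.map_eq, ← map_cond_preimage hX.aemeasurable hT, covariance_map_fun]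
  · rfl
  · exact Measurable.aestronglyMeasurable (by fun_prop)
  · exact Measurable.aestronglyMeasurable (by fun_prop)
  · exact hX'

/-- Quantiles, slabs and conditional covariances depend only on the law of `X`. Working with the
identity under that law also replaces almost everywhere measurability by measurability. -/
lemma equalSlabCov_benchmark_iff (hX : HasLaw X N P) (a : Fin n → ℝ) (β : Fin k → ℝ) :
    EqualSlabCov P X (benchmark a X) β ↔ EqualSlabCov N id (benchmark a id) β := by
  unfold EqualSlabCov
  simp_rw [quantileSlab_benchmark hX,
    condCovMatrix_preimage hX (measurableSet_quantileSlab (measurable_benchmark a) _ _)]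

end transfer

/-! ### Slabs of a normal variable in standard units -/

section standardized

variable {Ω : Type*} [MeasurableSpace Ω] {P : Measure Ω} [IsProbabilityMeasure P] {Y : Ω → ℝ}
  {m σ : ℝ} (hσ : 0 < σ) (hU : HasLaw (fun ω => (Y ω - m) / σ) (gaussianReal 0 1) P)

include hσ hU

lemma cdf_of_standardized (hY : Measurable Y) (y : ℝ) :
    cdf (P.map Y) y = stdCdf ((y - m) / σ) := by
  have := Measure.isProbabilityMeasure_map (μ := P) hY.aemeasurable
  rw [stdCdf, cdf_eq_real, cdf_eq_real, ← hU.map_eq, map_measureReal_apply hY measurableSet_Iic,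
    map_measureReal_apply (by fun_prop) measurableSet_Iic]
  congr 1
  ext ω
  simp [div_le_div_iff_of_pos_right hσ]

lemma quantile_of_standardized (hY : Measurable Y) {p : ℝ} (hp : p ∈ Ioo (0 : ℝ) 1) :
    quantile P Y p = m + σ * stdQuantile p := by
  obtain ⟨x, rfl⟩ := exists_stdCdf_eq hp
  have : {y : ℝ | stdCdf x ≤ cdf (P.map Y) y} = Ici (m + σ * x) := by
    ext y
    rw [mem_ofPred_eq, cdf_of_standardized hσ hU hY, strictMono_stdCdf.le_iff_le, le_div_iff₀ hσ,
      mem_Ici]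
    constructor <;> intro h <;> linarith
  rw [quantile, this, csInf_Ici, stdQuantile_stdCdf]

lemma quantileSlab_of_standardized (hY : Measurable Y) {k : ℕ} {β : Fin k → ℝ}
    (hβ : IsLevelSequence β) (j : Fin (k + 1)) :
    quantileSlab P Y β j =
      (fun ω => (Y ω - m) / σ) ⁻¹' stdSlab (extendLevels β j) (extendLevels β (j + 1)) := by
  have hlow : ∀ i ω, quantile P Y (β i) < Y ω ↔ stdQuantile (β i) < (Y ω - m) / σ := fun i ω => by
    rw [quantile_of_standardized hσ hU hY (hβ.2 i), lt_div_iff₀ hσ]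
    constructor <;> intro h <;> linarith
  have hupp : ∀ i ω, Y ω < quantile P Y (β i) ↔ (Y ω - m) / σ < stdQuantile (β i) := fun i ω => by
    rw [quantile_of_standardized hσ hU hY (hβ.2 i), div_lt_iff₀ hσ]
    constructor <;> intro h <;> linarith
  ext ω
  refine and_congr ?_ ?_
  · simp_rw [hlow]
    refine Fin.cases ?_ (fun i => ?_) j
    · simp
    · simp [(hβ.2 i).1]
  · simp_rw [hupp]
    refine Fin.lastCases ?_ (fun i => ?_) j
    · simp [Fin.castSucc_ne_last]
    · simp [(hβ.2 i).2]

lemma measure_slab_ne_zero (hY : Measurable Y) {k : ℕ} {β : Fin k → ℝ}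
    (hβ : IsLevelSequence β) (j : Fin (k + 1)) : P (quantileSlab P Y β j) ≠ 0 := by
  have hj : (j : ℕ) ≤ k := Nat.lt_succ_iff.1 j.2
  rw [quantileSlab_of_standardized hσ hU hY hβ, ← Measure.map_apply (by fun_prop)
    (measurableSet_stdSlab _ _), hU.map_eq]
  intro h
  have h2 := gaussianReal_stdSlab (hβ.extendLevels_mem j).1 (hβ.extendLevels_lt hj)
    (hβ.extendLevels_mem (j + 1)).2
  rw [measureReal_def, h, ENNReal.toReal_zero] at h2
  linarith [hβ.extendLevels_lt hj]

lemma variance_cond_quantileSlab (hY : Measurable Y) {k : ℕ} {β : Fin k → ℝ}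
    (hβ : IsLevelSequence β) (j : Fin (k + 1)) :
    Var[Y; ProbabilityTheory.cond P (quantileSlab P Y β j)] =
      σ ^ 2 * slabVar (extendLevels β j) (extendLevels β (j + 1)) := by
  have hj : (j : ℕ) ≤ k := Nat.lt_succ_iff.1 j.2
  have := cond_isProbabilityMeasure (measure_slab_ne_zero hσ hU hY hβ j)
  rw [← variance_cond_stdSlab (hβ.extendLevels_mem j).1 (hβ.extendLevels_lt hj)
    (hβ.extendLevels_mem (j + 1)).2, ← hU.map_eq,
    ← map_cond_preimage hU.aemeasurable (measurableSet_stdSlab _ _),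
    ← quantileSlab_of_standardized hσ hU hY hβ, variance_map aemeasurable_id (by fun_prop),
    Function.id_comp, ← variance_const_mul]
  have e : (fun ω => σ * ((Y ω - m) / σ)) = fun ω => Y ω - m := by
    funext ω
    field_simp
  rw [e, variance_sub_const hY.aestronglyMeasurable]

end standardized

/-! ### Regression of a Gaussian vector on its benchmark -/

section gaussian

variable {n k : ℕ} {μ : EuclideanSpace ℝ (Fin n)} {S : Matrix (Fin n) (Fin n) ℝ} {a : Fin n → ℝ}

/-- The coordinates are square integrable for a Gaussian distribution. -/
lemma memLp_coord (r : Fin n) :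
    MemLp (fun x : EuclideanSpace ℝ (Fin n) => x r) 2 (multivariateGaussian μ S) :=
  ((IsGaussian.hasGaussianLaw_id (μ := multivariateGaussian μ S)).map
    (EuclideanSpace.proj r : EuclideanSpace ℝ (Fin n) →L[ℝ] ℝ)).memLp_two

lemma memLp_benchmark : MemLp (benchmark a id) 2 (multivariateGaussian μ S) :=
  memLp_finsetSum _ fun i _ => (memLp_coord i).const_mul (a i)

lemma covariance_coord_benchmark (hS : S.PosSemidef) (r : Fin n) :
    cov[fun x : EuclideanSpace ℝ (Fin n) => x r, benchmark a id; multivariateGaussian μ S] =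
      S.mulVec a r := by
  have : (benchmark a id : EuclideanSpace ℝ (Fin n) → ℝ) = fun x => ∑ i, a i * x i := rfl
  rw [this, covariance_fun_sum_right (fun i => (memLp_coord i).const_mul (a i)) (memLp_coord r)]
  simp_rw [covariance_const_mul_right, covariance_eval_multivariateGaussian hS]
  simp [Matrix.mulVec, dotProduct, mul_comm]

lemma variance_benchmark (hS : S.PosSemidef) :
    Var[benchmark a id; multivariateGaussian μ S] = a ⬝ᵥ S.mulVec a := by
  rw [← covariance_self (measurable_benchmark a).aemeasurable]
  have : (benchmark a id : EuclideanSpace ℝ (Fin n) → ℝ) = fun x => ∑ i, a i * x i := rfl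
  conv_lhs => rw [this]
  rw [covariance_fun_sum_left (fun i => (memLp_coord i).const_mul (a i))
    (by rw [← this]; exact memLp_benchmark)]
  simp_rw [covariance_const_mul_left, ← this, covariance_coord_benchmark hS]
  simp [dotProduct]

lemma hasLaw_standardized_benchmark (hS : S.PosDef) (ha : a ≠ 0) : ∃ m σ : ℝ, 0 < σ ∧
    HasLaw (fun x => (benchmark a id x - m) / σ) (gaussianReal 0 1) (multivariateGaussian μ S) := by
  set N := multivariateGaussian μ S
  have hv : 0 < Var[benchmark a id; N] := by
    rw [variance_benchmark hS.posSemidef]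
    simpa using hS.dotProduct_mulVec_pos ha
  have hg : HasGaussianLaw (benchmark a id) N := by
    have := (IsGaussian.hasGaussianLaw_id (μ := N)).map
      (∑ i, a i • (EuclideanSpace.proj i : EuclideanSpace ℝ (Fin n) →L[ℝ] ℝ))
    exact this.congr (Eventually.of_forall fun x => by simp [benchmark])
  have hl : HasLaw (benchmark a id) (gaussianReal (N[benchmark a id])
      (Var[benchmark a id; N]).toNNReal) N := ⟨hg.aemeasurable, hg.map_eq_gaussianReal⟩
  refine ⟨N[benchmark a id], √(Var[benchmark a id; N]), Real.sqrt_pos.2 hv, ?_⟩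
  have h2 := gaussianReal_div_const (gaussianReal_sub_const hl (N[benchmark a id]))
    (√(Var[benchmark a id; N]))
  convert h2 using 2
  · simp
  · ext
    simp [Real.sq_sqrt hv.le, hv.le, hv.ne']

lemma equalSlabCov_iff (hS : S.PosDef) (ha : a ≠ 0) {β : Fin k → ℝ} (hβ : IsLevelSequence β) :
    EqualSlabCov (multivariateGaussian μ S) id (benchmark a id) β ↔ EqualSlabVar β := by
  obtain ⟨m, σ, hσ, hU⟩ := hasLaw_standardized_benchmark (μ := μ) hS ha
  set N := multivariateGaussian μ S
  set Y : EuclideanSpace ℝ (Fin n) → ℝ := benchmark a id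
  have hY : Measurable Y := measurable_benchmark a
  have hv : 0 < Var[Y; N] := by
    rw [variance_benchmark hS.posSemidef]
    simpa using hS.dotProduct_mulVec_pos ha
  -- The regression coefficients of the coordinates on `Y`, chosen so that the residual `Z` is
  -- uncorrelated with `Y`.
  set c : Fin n → ℝ := fun r => S.mulVec a r / Var[Y; N]
  set Z : EuclideanSpace ℝ (Fin n) → Fin n → ℝ := fun x r => x r - c r * Y x
  have hZ2 : ∀ r, MemLp (fun x => Z x r) 2 N := fun r =>
    (memLp_coord r).sub (memLp_benchmark.const_mul (c r))
  have hZ : Measurable Z := measurable_pi_iff.2 fun r => by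
    have : Measurable fun x : EuclideanSpace ℝ (Fin n) => x r := by fun_prop
    exact this.sub (hY.const_mul (c r))
  have hind : IndepFun Y Z N := by
    -- The criterion that uncorrelated implies independent is stated for two jointly Gaussian
    -- families, so `Y` is viewed as a family indexed by `Unit`.
    have hg : HasGaussianLaw (fun x => ((fun _ : Unit => Y x), fun r => Z x r)) N := by
      let ℓ : EuclideanSpace ℝ (Fin n) →L[ℝ] ℝ :=
        ∑ i, a i • (EuclideanSpace.proj i : EuclideanSpace ℝ (Fin n) →L[ℝ] ℝ)
      have hℓ : ∀ x, ℓ x = Y x := fun x => by simp [ℓ, Y, benchmark]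
      have := (IsGaussian.hasGaussianLaw_id (μ := N)).map
        ((ContinuousLinearMap.pi fun _ : Unit => ℓ).prod (ContinuousLinearMap.pi fun r =>
          (EuclideanSpace.proj r : EuclideanSpace ℝ (Fin n) →L[ℝ] ℝ) - c r • ℓ))
      refine this.congr (Eventually.of_forall fun x => ?_)
      ext
      · simp [hℓ]
      · simp [hℓ, Z]
    have h := hg.indepFun_of_covariance_eval (X := fun _ : Unit => Y) (Y := fun r x => Z x r)
      fun _ r => by
        rw [covariance_comm]
        have e : (fun x => Z x r) = fun x => x r - c r * Y x := rfl
        rw [e, covariance_fun_sub_left (memLp_coord r) (memLp_benchmark.const_mul (c r))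
          memLp_benchmark, covariance_const_mul_left, covariance_self hY.aemeasurable,
          covariance_coord_benchmark hS.posSemidef]
        change S.mulVec a r - S.mulVec a r / Var[Y; N] * Var[Y; N] = 0
        rw [div_mul_cancel₀ _ hv.ne', sub_self]
    exact h.comp (measurable_pi_apply ()) measurable_id
  have hT : Measurable fun y : ℝ => (y - m) / σ := by fun_prop
  have key : ∀ (j : Fin (k + 1)) (r s : Fin n), condCovMatrix N id (quantileSlab N Y β j) r s =
      c r * c s * (σ ^ 2 * slabVar (extendLevels β j) (extendLevels β (j + 1))) +
        cov[fun x => Z x r, fun x => Z x s; N] := by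
    intro j r s
    rw [← variance_cond_quantileSlab hσ hU hY hβ j]
    have hne := measure_slab_ne_zero hσ hU hY hβ j
    have hpre : quantileSlab N Y β j = Y ⁻¹' ((fun y : ℝ => (y - m) / σ) ⁻¹'
        stdSlab (extendLevels β j) (extendLevels β (j + 1))) :=
      quantileSlab_of_standardized hσ hU hY hβ j
    rw [hpre] at hne ⊢
    rw [← covariance_cond_add hind hY hZ (hT (measurableSet_stdSlab _ _)) hne memLp_benchmark hZ2
      c r s]
    simp [condCovMatrix, Z]
  -- If `c` vanished, so would `Σa` and with it `Var Y = a ⬝ Σa`. The diagonal entry at such an `r`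
  -- recovers the slab variance from the matrix.
  obtain ⟨r, hr⟩ : ∃ r, c r ≠ 0 := by
    by_contra! h0
    have h1 : ∀ r, S.mulVec a r = 0 := fun r => by
      have := h0 r
      simpa [c, hv.ne'] using this
    have h2 := variance_benchmark (μ := μ) (a := a) hS.posSemidef
    have h3 : S.mulVec a = 0 := funext h1
    rw [h3, dotProduct_zero] at h2
    exact hv.ne' h2
  constructor
  · intro h i hi j hj
    have := congrFun (congrFun (h ⟨i, Nat.lt_succ_of_le hi⟩ ⟨j, Nat.lt_succ_of_le hj⟩) r) r
    rw [key, key, add_left_inj] at this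
    have h1 := mul_left_cancel₀ (mul_ne_zero hr hr) this
    exact mul_left_cancel₀ (pow_ne_zero 2 hσ.ne') h1
  · intro h i j
    ext r s
    rw [key, key, h i (Nat.lt_succ_iff.1 i.2) j (Nat.lt_succ_iff.1 j.2)]

end gaussian

end

theorem mainTheorem2 :
    ∃ α : (k : ℕ) → Fin k → ℝ,
      (∀ k : ℕ, IsLevelSequence (α k)) ∧
      (∀ (k n : ℕ) (μ : EuclideanSpace ℝ (Fin n)) (S : Matrix (Fin n) (Fin n) ℝ) (a : Fin n → ℝ)
        (Ω : Type*) [MeasurableSpace Ω] (P : Measure Ω) [IsProbabilityMeasure P]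
        (X : Ω → EuclideanSpace ℝ (Fin n)),
        S.PosDef → a ≠ 0 → HasLaw X (multivariateGaussian μ S) P →
          EqualSlabCov P X (benchmark a X) (α k) ∧
          ∀ β : Fin k → ℝ, IsLevelSequence β → EqualSlabCov P X (benchmark a X) β → β = α k) ∧
      |α 2 0 - 0.20| < 0.005 ∧ |(α 2 1 - α 2 0) - 0.60| < 0.005 ∧ |(1 - α 2 1) - 0.20| < 0.005 := by
  choose α hα hV huniq using exists_equalSlabVar
  refine ⟨α, hα, ?_, two_levels_near (hα 2) (hV 2) (huniq 2)⟩
  intro k n μ S a Ω _ P _ X hS ha hX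
  refine ⟨?_, fun β hβ h => huniq k β hβ ?_⟩
  · rw [equalSlabCov_benchmark_iff hX, equalSlabCov_iff hS ha (hα k)]
    exact hV k
  · rwa [equalSlabCov_benchmark_iff hX, equalSlabCov_iff hS ha hβ] at h
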